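/- Let $T\in\mathbb{N}^*$, $\rho>0$ and $\alpha\in\mathbb{R}$. For $N\in\mathbb{N}^*$, let $W=W_N$ be a symmetric $N\times N$ random matrix whose entries on and above the diagonal are i.i.d. centred Gaussian random variables with standard deviation $\rho/N^{\alpha}$. For $1\le i\le N$ put $\beta_{i,0}=1$ and $$\beta_{i,l}=\sum_{i_1,\dots,i_l=1}^N W_{ii_1}W_{i_1i_2}\cdots W_{i_{l-1}i_l}\qquad (l\ge 1),$$ and let $B_{T,N}$ be the real symmetric $(T+1)\times(T+1)$ matrix with entries $$B_{T,N}(l_1,l_2)=\mathbb{E}\sum_{i=1}^N\beta_{i,l_1}\beta_{i,l_2},\qquad 0\le l_1,l_2\le T,$$ where all these expectations exist. For a real symmetric matrix $A$ of size $T+1$, let $\lambda_{\min}(A)=\lambda_T(A)\le\dots\le\lambda_0(A)=\lambda_{\max}(A)$ be its eigenvalues counted with multiplicity. Let $A_{\mathrm{sc}}(\rho,T)$ be the $(T+1)\times(T+1)$ matrix with entries $$A_{\mathrm{sc}}(\rho,T)_{l_1,l_2}=\begin{cases}0&\text{if } l_1+l_2\text{ is odd},\\[2pt] \dfrac{\rho^{l_1+l_2}}{\frac{l_1+l_2}{2}+1}\dbinom{l_1+l_2}{\frac{l_1+l_2}{2}}&\text{if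 } l_1+l_2\text{ is even}.\end{cases}$$ This is the Hankel matrix of moments of the rescaled semicircle law, i.e. $A_{\mathrm{sc}}(\rho,T)_{l_1,l_2}=\int x^{l_1+l_2}\,d\mu_\rho(x)$, where $\mu_\rho$ is the probability measure on $\mathbb{R}$ with density $\frac{1}{2\pi\rho^2}\sqrt{\max(4\rho^2-x^2,0)}$. Write $x_N\simeq y_N$ if $x_N/y_N\to1$ as $N\to\infty$. Then the following hold. 1. If $\alpha=1/2$, then, as $N\to\infty$, $\frac1N B_{T,N}\to A_{\mathrm{sc}}(\rho,T)$ entrywise, $$\frac{\lambda_{\max}(B_{T,N})}{N}\to\lambda_{\max}(A_{\mathrm{sc}}(\rho,T)),\qquad \frac{\lambda_{\min}(B_{T,N})}{N}\to\lambda_{\min}(A_{\mathrm{sc}}(\rho,T)),$$ and $$\frac{\lambda_{\max}(B_{T,N})}{\sum_{i=0}^T\lambda_i(B_{T,N})}\to\frac{\lambda_{\max}(A_{\mathrm{sc}}(\rho,T))}{\mathrm{tr}(A_{\mathrm{sc}}(\rho,T))}.$$ 2. If $\alpha<1/2$, then $$\lambda_{\max}(B_{T,N})\simeq\frac{\rho^{2T}}{T+1}\binom{2T}{T}N^{1+2T\left(\frac12-\alpha\right)}\qquad\text{and}\qquad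 \lim_{N\to\infty}\frac{\lambda_{\max}(B_{T,N})}{\sum_{i=0}^T\lambda_i(B_{T,N})}=1.$$ 3. If $\alpha>1/2$, then $$\lambda_{\max}(B_{T,N})\simeq N\qquad\text{and}\qquad \lim_{N\to\infty}\frac{\lambda_{\max}(B_{T,N})}{\sum_{i=0}^T\lambda_i(B_{T,N})}=1.$$ -/

import Mathlib

open MeasureTheory ProbabilityTheory Filter Topology Asymptotics

noncomputable section

/-- `β_{i,l} = ∑_{i₁,…,i_l} W_{i i₁} W_{i₁ i₂} ⋯ W_{i_{l-1} i_l}`. The tuple `j` is `(i₁,…,i_l)` and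
`Fin.cons i j` is `(i,i₁,…,i_l)`; for `l = 0` there is one (empty) tuple and the value is `1`. -/
def pathSum {N : ℕ} (W : Matrix (Fin N) (Fin N) ℝ) (i : Fin N) (l : ℕ) : ℝ :=
  ∑ j : Fin l → Fin N,
    ∏ k : Fin l, W ((Fin.cons i j : Fin (l + 1) → Fin N) k.castSucc) (j k)

/-- The generalised matrix of moments of order `T` of a random matrix `W` with `N` rows:
`B_{T,N}(l₁,l₂) = 𝔼 ∑ᵢ β_{i,l₁} β_{i,l₂}`, `0 ≤ l₁, l₂ ≤ T`. -/
def genMomentMatrix {Ω : Type*} [MeasurableSpace Ω] (P : Measure Ω) {N : ℕ}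
    (W : Ω → Matrix (Fin N) (Fin N) ℝ) (T : ℕ) : Matrix (Fin (T + 1)) (Fin (T + 1)) ℝ :=
  Matrix.of fun l₁ l₂ => ∫ ω, ∑ i, pathSum (W ω) i l₁ * pathSum (W ω) i l₂ ∂P

theorem genMomentMatrix_isHermitian {Ω : Type*} [MeasurableSpace Ω] (P : Measure Ω) {N : ℕ}
    (W : Ω → Matrix (Fin N) (Fin N) ℝ) (T : ℕ) : (genMomentMatrix P W T).IsHermitian := by
  ext l₁ l₂
  simp [genMomentMatrix, mul_comm]

/-- `W` is (almost surely) symmetric and its entries on and above the diagonal are i.i.d. centred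
Gaussian random variables with standard deviation `σ`. -/
structure IsSymmetricGaussian {Ω : Type*} [MeasurableSpace Ω] (P : Measure Ω) {N : ℕ}
    (W : Ω → Matrix (Fin N) (Fin N) ℝ) (σ : ℝ) : Prop where
  symm : ∀ᵐ ω ∂P, (W ω).IsSymm
  law : ∀ i j : Fin N, i ≤ j → HasLaw (fun ω => W ω i j) (gaussianReal 0 (σ ^ 2).toNNReal) P
  indep : iIndepFun (fun (p : {p : Fin N × Fin N // p.1 ≤ p.2}) ω => W ω p.1.1 p.1.2) P

/-- The eigenvalues `λ_0 ≥ λ_1 ≥ ⋯ ≥ λ_T` of a real symmetric matrix of size `T + 1`, counted with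
multiplicity. -/
def sortedEigenvalue {T : ℕ} {A : Matrix (Fin (T + 1)) (Fin (T + 1)) ℝ} (hA : A.IsHermitian)
    (k : Fin (T + 1)) : ℝ :=
  hA.eigenvalues₀ (Fin.cast (Fintype.card_fin (T + 1)).symm k)

def lambdaMax {T : ℕ} {A : Matrix (Fin (T + 1)) (Fin (T + 1)) ℝ} (hA : A.IsHermitian) : ℝ :=
  sortedEigenvalue hA 0

def lambdaMin {T : ℕ} {A : Matrix (Fin (T + 1)) (Fin (T + 1)) ℝ} (hA : A.IsHermitian) : ℝ :=
  sortedEigenvalue hA (Fin.last T)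

def dominanceRatio {T : ℕ} {A : Matrix (Fin (T + 1)) (Fin (T + 1)) ℝ} (hA : A.IsHermitian) : ℝ :=
  lambdaMax hA / ∑ k, sortedEigenvalue hA k

/-- `A_sc(ρ,T)`; here `(l₁ + l₂) / 2` is the exact half, as `l₁ + l₂` is even in that branch. -/
def semicircleMatrix (ρ : ℝ) (T : ℕ) : Matrix (Fin (T + 1)) (Fin (T + 1)) ℝ :=
  Matrix.of fun l₁ l₂ =>
    if Odd ((l₁ : ℕ) + (l₂ : ℕ)) then 0
    else ρ ^ ((l₁ : ℕ) + (l₂ : ℕ)) / ((((l₁ : ℕ) + (l₂ : ℕ)) / 2 : ℕ) + 1 : ℝ) *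
      (Nat.choose ((l₁ : ℕ) + (l₂ : ℕ)) (((l₁ : ℕ) + (l₂ : ℕ)) / 2) : ℝ)

theorem semicircleMatrix_isHermitian (ρ : ℝ) (T : ℕ) : (semicircleMatrix ρ T).IsHermitian := by
  ext l₁ l₂
  simp [semicircleMatrix, add_comm]

/-- The semicircle law rescaled by `ρ`, with density `√(max (4ρ² - x²) 0) / (2πρ²)`. -/
def semicircleLaw (ρ : ℝ) : Measure ℝ :=
  volume.withDensity fun x =>
    ENNReal.ofReal (1 / (2 * Real.pi * ρ ^ 2) * Real.sqrt (max (4 * ρ ^ 2 - x ^ 2) 0))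

end

/-! For symmetric `W` the sum `∑ᵢ β_{i,l₁} β_{i,l₂}` is the sum of all entries of `W ^ (l₁ + l₂)`.
Flipping the sign of one row and column preserves the Gaussian law, so off-diagonal entries of a
power have mean zero (`wickExp_genericSymm_pow_of_ne`) and `B(l₁,l₂) = 𝔼 tr W^(l₁+l₂)`. With `c = ρ
N^(1/2-α)` and `m_k` the semicircle moments, rescaling to variance `1/N` and Wigner's theorem give
`B(l₁,l₂)/N = c^(l₁+l₂) (m_(l₁+l₂) + o(1))` (`genMomentMatrix_div_eq`, `tendsto_wickExp_tracePow`).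
If `α = 1/2` then `c = ρ`. If `α < 1/2` then `c → ∞` and the corner `(T,T)` dominates. If `α > 1/2`
then `c → 0` and only the corner `(0,0)` survives. Extreme eigenvalues are Lipschitz in the entries
and the eigenvalues sum to the trace, so all spectral limits follow
(`tendsto_eigenvalues_of_tendsto_div`).

Wigner's theorem is proved algebraically. The expectation is a linear functional `wickExp` on
polynomials in the entries, and integration by parts (`wickExp_X_mul`) yields the loop equation
`wickExp_tracePow_succ_mul`: a trace splits into products of two traces, plus corrections. The
leading part is the Catalan recursion. Working with products of traces closes the induction. Since
all polynomials involved have nonnegative coefficients, dropping corrections gives a lower bound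
(`le_wickExp_traceProd`), and dominating them by products with fewer traces gives an upper bound
with relative error `O(1/N)` (`wickExp_traceProd_le`). -/

noncomputable section

/-! ### Gaussian expectation as a functional on polynomials. -/

/-- Moments of the centred Gaussian law with variance `s`. -/
def gaussMoment (s : ℝ) : ℕ → ℝ
  | 0 => 1
  | 1 => 0
  | n + 2 => s * (n + 1) * gaussMoment s n

/-- At `n = 0` the truncated `n - 1` is harmless because the factor `n` vanishes; this is the shape
produced by differentiating a monomial. -/
theorem gaussMoment_succ (s : ℝ) (n : ℕ) :
    gaussMoment s (n + 1) = s * n * gaussMoment s (n - 1) := by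
  cases n with
  | zero => simp [gaussMoment]
  | succ n => simp [gaussMoment]

theorem gaussMoment_nonneg {s : ℝ} (hs : 0 ≤ s) : ∀ n, 0 ≤ gaussMoment s n
  | 0 => zero_le_one
  | 1 => le_rfl
  | n + 2 => mul_nonneg (by positivity) (gaussMoment_nonneg hs n)

theorem pow_mul_gaussMoment (c s : ℝ) : ∀ n, c ^ n * gaussMoment s n = gaussMoment (c ^ 2 * s) n
  | 0 => by simp [gaussMoment]
  | 1 => by simp [gaussMoment]
  | n + 2 => by
    simp only [gaussMoment]
    rw [← pow_mul_gaussMoment c s n]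
    ring

section Wick

variable {ι : Type*}

/-- The expectation of a polynomial in independent centred Gaussian variables of variance `s`. -/
def wickExp [Fintype ι] (s : ℝ) : MvPolynomial ι ℝ →ₗ[ℝ] ℝ :=
  (MvPolynomial.basisMonomials ι ℝ).constr ℝ fun m => ∏ p, gaussMoment s (m p)

theorem wickExp_monomial [Fintype ι] (s : ℝ) (m : ι →₀ ℕ) (a : ℝ) :
    wickExp s (MvPolynomial.monomial m a) = a * ∏ p, gaussMoment s (m p) := by
  have h : MvPolynomial.monomial m a = a • (MvPolynomial.basisMonomials ι ℝ m) := by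
    simp [MvPolynomial.smul_monomial]
  rw [h, map_smul, wickExp, Module.Basis.constr_basis, smul_eq_mul]

theorem wickExp_one [Fintype ι] (s : ℝ) : wickExp s (1 : MvPolynomial ι ℝ) = 1 := by
  rw [MvPolynomial.one_def, wickExp_monomial]
  simp [gaussMoment]

/-- Gaussian integration by parts. -/
theorem wickExp_X_mul [Fintype ι] (s : ℝ) (p : ι) (F : MvPolynomial ι ℝ) :
    wickExp s (MvPolynomial.X p * F) = s * wickExp s (MvPolynomial.pderiv p F) := by
  classical
  induction F using MvPolynomial.induction_on' with
  | add F G hF hG => simp only [mul_add, map_add, hF, hG]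
  | monomial m a =>
    -- Only the factor at `p` changes: its exponent is raised on the left and lowered on the right,
    -- so the claim reduces to `gaussMoment_succ`.
    rw [MvPolynomial.X, MvPolynomial.monomial_mul, MvPolynomial.pderiv_monomial, wickExp_monomial,
      wickExp_monomial, Fintype.prod_eq_mul_prod_compl p,
      Fintype.prod_eq_mul_prod_compl p
        (fun q => gaussMoment s ((m - Finsupp.single p 1 : ι →₀ ℕ) q))]
    have h₁ : ∏ i ∈ {p}ᶜ, gaussMoment s ((Finsupp.single p 1 + m : ι →₀ ℕ) i) =
        ∏ i ∈ {p}ᶜ, gaussMoment s (m i) :=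
      Finset.prod_congr rfl fun i hi => by
        have : p ≠ i := by simpa [eq_comm] using hi
        simp [this]
    have h₂ : ∏ i ∈ {p}ᶜ, gaussMoment s ((m - Finsupp.single p 1 : ι →₀ ℕ) i) =
        ∏ i ∈ {p}ᶜ, gaussMoment s (m i) :=
      Finset.prod_congr rfl fun i hi => by
        have : p ≠ i := by simpa [eq_comm] using hi
        simp [this]
    rw [h₁, h₂]
    have h₃ : (Finsupp.single p 1 + m : ι →₀ ℕ) p = m p + 1 := by simp [add_comm]
    have h₄ : (m - Finsupp.single p 1 : ι →₀ ℕ) p = m p - 1 := by simp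
    rw [h₃, h₄, gaussMoment_succ]
    ring

/-- Rescaling the variables in a Gaussian expectation. -/
theorem wickExp_rescale [Fintype ι] (s s' : ℝ) (ε : ι → ℝ)
    (h : ∀ p n, ε p ^ n * gaussMoment s n = gaussMoment s' n) (F : MvPolynomial ι ℝ) :
    wickExp s (MvPolynomial.aeval (fun p => MvPolynomial.C (ε p) * MvPolynomial.X p) F) =
      wickExp s' F := by
  induction F using MvPolynomial.induction_on' with
  | add F G hF hG => simp only [map_add, hF, hG]
  | monomial m a =>
    have : MvPolynomial.aeval (fun p => MvPolynomial.C (ε p) * MvPolynomial.X p)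
        (MvPolynomial.monomial m a) = MvPolynomial.monomial m (a * ∏ p, ε p ^ m p) := by
      rw [MvPolynomial.aeval_monomial, MvPolynomial.monomial_eq (a := a * _),
        Finsupp.prod_fintype _ _ (by simp), Finsupp.prod_fintype _ _ (by simp)]
      simp [mul_pow, Finset.prod_mul_distrib, mul_assoc, MvPolynomial.algebraMap_eq]
    rw [this, wickExp_monomial, wickExp_monomial, mul_assoc, ← Finset.prod_mul_distrib]
    simp only [h]

variable (ι) in
/-- The polynomials with nonnegative coefficients. -/
def nonnegCoeff : Subsemiring (MvPolynomial ι ℝ) where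
  carrier := {F | ∀ m, 0 ≤ F.coeff m}
  mul_mem' {F G} hF hG m := by
    classical
    rw [MvPolynomial.coeff_mul]
    exact Finset.sum_nonneg fun x _ => mul_nonneg (hF _) (hG _)
  one_mem' m := by
    classical
    rw [MvPolynomial.coeff_one]
    split_ifs <;> simp
  add_mem' {F G} hF hG m := by
    rw [MvPolynomial.coeff_add]
    exact add_nonneg (hF m) (hG m)
  zero_mem' m := by simp

theorem X_mem_nonnegCoeff (p : ι) : (MvPolynomial.X p : MvPolynomial ι ℝ) ∈ nonnegCoeff ι := by
  classical
  intro m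
  rw [MvPolynomial.coeff_X]
  split_ifs <;> simp

theorem pderiv_mem_nonnegCoeff (p : ι) {F : MvPolynomial ι ℝ} (hF : F ∈ nonnegCoeff ι) :
    MvPolynomial.pderiv p F ∈ nonnegCoeff ι := by
  classical
  rw [F.as_sum, map_sum]
  refine sum_mem fun m _ n => ?_
  rw [MvPolynomial.pderiv_monomial, MvPolynomial.coeff_monomial]
  split_ifs
  · exact mul_nonneg (hF m) (Nat.cast_nonneg _)
  · exact le_rfl

theorem wickExp_nonneg [Fintype ι] {s : ℝ} (hs : 0 ≤ s) {F : MvPolynomial ι ℝ}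
    (hF : F ∈ nonnegCoeff ι) :
    0 ≤ wickExp s F := by
  rw [F.as_sum, map_sum]
  refine Finset.sum_nonneg fun m _ => ?_
  rw [wickExp_monomial]
  exact mul_nonneg (hF m) (Finset.prod_nonneg fun p _ => gaussMoment_nonneg hs _)

/-- Coefficientwise domination suffices because all Gaussian moments are nonnegative. The upper
bounds on correction terms below rest on this. -/
theorem wickExp_mono [Fintype ι] {s : ℝ} (hs : 0 ≤ s) {F G : MvPolynomial ι ℝ}
    (h : G - F ∈ nonnegCoeff ι) : wickExp s F ≤ wickExp s G := by
  have := wickExp_nonneg hs h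
  rwa [map_sub, sub_nonneg] at this

end Wick

/-! ### Differentiating powers of the generic symmetric matrix; the loop equation. -/

theorem derivation_matrix_mul {n A : Type*} [Fintype n] [CommRing A] [Algebra ℝ A]
    (D : Derivation ℝ A A) (M M' : Matrix n n A) :
    (M * M').map D = M.map D * M' + M * M'.map D := by
  ext i j
  simp only [Matrix.map_apply, Matrix.mul_apply, map_sum, Matrix.add_apply, Derivation.leibniz,
    smul_eq_mul, ← Finset.sum_add_distrib]
  exact Finset.sum_congr rfl fun x _ => by ring

/-- The Leibniz rule for powers of a matrix. -/
theorem derivation_matrix_pow {n A : Type*} [Fintype n] [DecidableEq n] [CommRing A] [Algebra ℝ A]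
    (D : Derivation ℝ A A) (M : Matrix n n A) (k : ℕ) :
    (M ^ (k + 1)).map D =
      ∑ p ∈ Finset.HasAntidiagonal.antidiagonal k, M ^ p.1 * M.map D * M ^ p.2 := by
  induction k with
  | zero => simp
  | succ k ih =>
    rw [pow_succ, derivation_matrix_mul, ih, Finset.Nat.sum_antidiagonal_succ', Finset.sum_mul]
    rw [add_comm]
    simp only [pow_zero, mul_one, pow_succ, mul_assoc]

/-- Positions on and above the diagonal. -/
abbrev UpperIndex (N : ℕ) := {p : Fin N × Fin N // p.1 ≤ p.2}

/-- The position on or above the diagonal holding the `(i,j)` entry of a symmetric matrix. -/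
def upperIndex {N : ℕ} (i j : Fin N) : UpperIndex N :=
  ⟨(min i j, max i j), min_le_max⟩

theorem upperIndex_comm {N : ℕ} (i j : Fin N) : upperIndex i j = upperIndex j i := by
  simp [upperIndex, min_comm, max_comm]

theorem upperIndex_eq_iff {N : ℕ} (i j a b : Fin N) :
    upperIndex i j = upperIndex a b ↔ (i = a ∧ j = b) ∨ (i = b ∧ j = a) := by
  simp only [upperIndex, Subtype.mk.injEq, Prod.mk.injEq]
  grind

/-- The generic symmetric matrix. -/
def genericSymm (N : ℕ) : Matrix (Fin N) (Fin N) (MvPolynomial (UpperIndex N) ℝ) :=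
  Matrix.of fun i j => MvPolynomial.X (upperIndex i j)

section Generic

variable {N : ℕ}

theorem genericSymm_transpose : (genericSymm N).transpose = genericSymm N := by
  ext1 i j
  simp [genericSymm, upperIndex_comm]

theorem genericSymm_pow_apply_comm (k : ℕ) (i j : Fin N) :
    (genericSymm N ^ k) i j = (genericSymm N ^ k) j i := by
  conv_lhs => rw [← genericSymm_transpose, ← Matrix.transpose_pow, Matrix.transpose_apply]

theorem genericSymm_pow_mem (k : ℕ) (i j : Fin N) :
    (genericSymm N ^ k) i j ∈ nonnegCoeff (UpperIndex N) := by
  induction k generalizing i j with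
  | zero =>
    rw [pow_zero, Matrix.one_apply]
    split_ifs
    · exact one_mem _
    · exact zero_mem _
  | succ k ih =>
    rw [pow_succ, Matrix.mul_apply]
    exact sum_mem fun x _ => mul_mem (ih _ _) (X_mem_nonnegCoeff _)

/-- Traces of powers of the generic symmetric matrix. -/
def tracePow (N k : ℕ) : MvPolynomial (UpperIndex N) ℝ := (genericSymm N ^ k).trace

theorem tracePow_mem (k : ℕ) : tracePow N k ∈ nonnegCoeff (UpperIndex N) :=
  sum_mem fun i _ => genericSymm_pow_mem k i i

theorem tracePow_zero : tracePow N 0 = (N : MvPolynomial (UpperIndex N) ℝ) := by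
  simp [tracePow]

/-- Products of traces of powers. -/
def traceProd (N : ℕ) (L : List ℕ) : MvPolynomial (UpperIndex N) ℝ := (L.map (tracePow N)).prod

theorem traceProd_cons (k : ℕ) (L : List ℕ) :
    traceProd N (k :: L) = tracePow N k * traceProd N L := by
  simp [traceProd]

theorem traceProd_append (L L' : List ℕ) :
    traceProd N (L ++ L') = traceProd N L * traceProd N L' := by
  simp [traceProd]

theorem traceProd_mem (L : List ℕ) : traceProd N L ∈ nonnegCoeff (UpperIndex N) := by
  refine list_prod_mem fun x hx => ?_
  obtain ⟨k, -, rfl⟩ := List.mem_map.1 hx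
  exact tracePow_mem k

/-- A variable off the diagonal occupies two entries, a diagonal one only one. -/
theorem genericSymm_map_pderiv (i j : Fin N) :
    (genericSymm N).map (MvPolynomial.pderiv (upperIndex i j)) =
      Matrix.single j i 1 + if i = j then 0 else Matrix.single i j 1 := by
  refine Matrix.ext fun a b => ?_
  rw [Matrix.map_apply, genericSymm, Matrix.of_apply, MvPolynomial.pderiv_X, Matrix.add_apply,
    Pi.single_apply]
  simp only [upperIndex_eq_iff]
  by_cases hij : i = j
  · simp only [hij, Matrix.single_apply, if_true, Matrix.zero_apply]
    grind
  · simp only [hij, Matrix.single_apply, if_false]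
    grind

theorem sum_single_add (F : Fin N → Fin N → MvPolynomial (UpperIndex N) ℝ) :
    ∑ i, ∑ j, F i j = (∑ i, ∑ j, if i = j then 0 else F i j) + ∑ i, F i i := by
  rw [← Finset.sum_add_distrib]
  refine Finset.sum_congr rfl fun i _ => ?_
  have : F i i = ∑ j, if i = j then F i j else 0 := by simp
  rw [this, ← Finset.sum_add_distrib]
  refine Finset.sum_congr rfl fun j _ => ?_
  split_ifs <;> simp

/-- The off-diagonal part of `∑ (X^a)_{ij} (X^b)_{ij}`. -/
def offDiagTrace (N a b : ℕ) : MvPolynomial (UpperIndex N) ℝ :=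
  ∑ i, ∑ j, if i = j then 0 else (genericSymm N ^ a) j i * (genericSymm N ^ b) j i

theorem offDiagTrace_mem (a b : ℕ) : offDiagTrace N a b ∈ nonnegCoeff (UpperIndex N) := by
  refine sum_mem fun i _ => sum_mem fun j _ => ?_
  split_ifs
  · exact zero_mem _
  · exact mul_mem (genericSymm_pow_mem _ _ _) (genericSymm_pow_mem _ _ _)

theorem sum_pow_mul_pow (a b : ℕ) :
    ∑ i, ∑ j, (genericSymm N ^ a) j i * (genericSymm N ^ b) j i = tracePow N (a + b) := by
  rw [tracePow, pow_add, Matrix.trace]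
  refine Finset.sum_congr rfl fun i _ => ?_
  rw [Matrix.diag_apply, Matrix.mul_apply]
  exact Finset.sum_congr rfl fun j _ => by rw [genericSymm_pow_apply_comm a]

/-- The difference is the diagonal part of the double sum. Thus an off-diagonal correction costs at
most one trace, where the leading term has two. -/
theorem tracePow_sub_offDiagTrace_mem (a b : ℕ) :
    tracePow N (a + b) - offDiagTrace N a b ∈ nonnegCoeff (UpperIndex N) := by
  rw [← sum_pow_mul_pow, sum_single_add, offDiagTrace, add_sub_cancel_left]
  exact sum_mem fun i _ => mul_mem (genericSymm_pow_mem _ _ _) (genericSymm_pow_mem _ _ _)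

/-- In the Leibniz rule the unit matrix at `(j,i)` separates the indices and gives a product of two
traces; its transpose, present only for `i ≠ j`, gives `offDiagTrace`. -/
theorem sum_pderiv_pow_apply (k : ℕ) :
    ∑ i, ∑ j, MvPolynomial.pderiv (upperIndex i j) ((genericSymm N ^ (k + 1)) j i) =
      ∑ p ∈ Finset.HasAntidiagonal.antidiagonal k,
        (tracePow N p.1 * tracePow N p.2 + offDiagTrace N p.1 p.2) := by
  have h (i j : Fin N) : MvPolynomial.pderiv (upperIndex i j) ((genericSymm N ^ (k + 1)) j i) =
      ∑ p ∈ Finset.HasAntidiagonal.antidiagonal k,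
        ((genericSymm N ^ p.1) j j * (genericSymm N ^ p.2) i i +
          if i = j then 0 else (genericSymm N ^ p.1) j i * (genericSymm N ^ p.2) j i) := by
    have := congrFun (congrFun
      (derivation_matrix_pow (MvPolynomial.pderiv (upperIndex i j)) (genericSymm N) k) j) i
    rw [Matrix.map_apply, genericSymm_map_pderiv] at this
    rw [this, Matrix.sum_apply]
    refine Finset.sum_congr rfl fun p _ => ?_
    rw [mul_add, add_mul, Matrix.add_apply]
    congr 1
    · simp [Matrix.mul_apply, Matrix.single_apply, ite_and]
    · split_ifs
      · simp
      · simp [Matrix.mul_apply, Matrix.single_apply, ite_and]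
  simp only [h]
  rw [Finset.sum_congr rfl fun i _ => Finset.sum_comm, Finset.sum_comm]
  refine Finset.sum_congr rfl fun p _ => ?_
  simp only [Finset.sum_add_distrib]
  rw [offDiagTrace, add_left_inj, tracePow, tracePow, Matrix.trace, Matrix.trace,
    Finset.sum_mul_sum, Finset.sum_comm]
  rfl

/-- By cyclicity of the trace all `k + 1` Leibniz terms coincide. -/
theorem pderiv_tracePow_succ (k : ℕ) (i j : Fin N) :
    MvPolynomial.pderiv (upperIndex i j) (tracePow N (k + 1)) =
      (k + 1) * ((genericSymm N ^ k) i j + if i = j then 0 else (genericSymm N ^ k) j i) := by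
  have : MvPolynomial.pderiv (upperIndex i j) (tracePow N (k + 1)) =
      ((genericSymm N ^ (k + 1)).map (MvPolynomial.pderiv (upperIndex i j))).trace := by
    simp [tracePow, Matrix.trace]
  rw [this, derivation_matrix_pow, Matrix.trace_sum, genericSymm_map_pderiv]
  have h (p : ℕ × ℕ) (hp : p ∈ Finset.HasAntidiagonal.antidiagonal k) : (genericSymm N ^ p.1 *
      (Matrix.single j i 1 + if i = j then 0 else Matrix.single i j 1) *
        genericSymm N ^ p.2).trace =
        (genericSymm N ^ k) i j + if i = j then 0 else (genericSymm N ^ k) j i := by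
    rw [Matrix.trace_mul_comm, ← mul_assoc, ← pow_add, add_comm,
      Finset.HasAntidiagonal.mem_antidiagonal.1 hp,
      mul_add, Matrix.trace_add, Matrix.trace_mul_single]
    split_ifs
    · simp
    · simp [Matrix.trace_mul_single]
  rw [Finset.sum_congr rfl h, Finset.sum_const, Finset.Nat.card_antidiagonal, nsmul_eq_mul]
  push_cast
  rfl

/-- The contribution of derivatives falling on the other factors in integration by parts. -/
def crossTerm (N k : ℕ) (Q : MvPolynomial (UpperIndex N) ℝ) : MvPolynomial (UpperIndex N) ℝ :=
  ∑ i, ∑ j, (genericSymm N ^ k) j i * MvPolynomial.pderiv (upperIndex i j) Q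

theorem crossTerm_mem (k : ℕ) {Q : MvPolynomial (UpperIndex N) ℝ}
    (hQ : Q ∈ nonnegCoeff (UpperIndex N)) : crossTerm N k Q ∈ nonnegCoeff (UpperIndex N) :=
  sum_mem fun _ _ => sum_mem fun _ _ =>
    mul_mem (genericSymm_pow_mem _ _ _) (pderiv_mem_nonnegCoeff _ hQ)

theorem crossTerm_mul (k : ℕ) (Q R : MvPolynomial (UpperIndex N) ℝ) :
    crossTerm N k (Q * R) = crossTerm N k Q * R + Q * crossTerm N k R := by
  simp only [crossTerm, Finset.sum_mul, Finset.mul_sum, ← Finset.sum_add_distrib,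
    Derivation.leibniz, smul_eq_mul]
  exact Finset.sum_congr rfl fun i _ => Finset.sum_congr rfl fun j _ => by ring

theorem crossTerm_tracePow_zero (k : ℕ) : crossTerm N k (tracePow N 0) = 0 := by
  simp [crossTerm, tracePow_zero]

theorem crossTerm_tracePow_succ (k t : ℕ) :
    crossTerm N k (tracePow N (t + 1)) =
      (t + 1) * (tracePow N (k + t) + offDiagTrace N k t) := by
  simp only [crossTerm, pderiv_tracePow_succ]
  rw [← sum_pow_mul_pow, offDiagTrace, ← Finset.sum_add_distrib, Finset.mul_sum]
  refine Finset.sum_congr rfl fun i _ => ?_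
  rw [← Finset.sum_add_distrib, Finset.mul_sum]
  refine Finset.sum_congr rfl fun j _ => ?_
  rw [genericSymm_pow_apply_comm t i j]
  split_ifs <;> ring

/-- The loop equation. -/
theorem wickExp_tracePow_succ_mul (s : ℝ) (k : ℕ) (Q : MvPolynomial (UpperIndex N) ℝ) :
    wickExp s (tracePow N (k + 1) * Q) =
      s * wickExp s ((∑ i, ∑ j,
        MvPolynomial.pderiv (upperIndex i j) ((genericSymm N ^ k) j i)) * Q) +
      s * wickExp s (crossTerm N k Q) := by
  -- One factor of the matrix is peeled off each trace so that integration by parts applies to its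
  -- entry.
  have h : tracePow N (k + 1) * Q =
      ∑ i, ∑ j, MvPolynomial.X (upperIndex i j) * ((genericSymm N ^ k) j i * Q) := by
    rw [tracePow, pow_succ', Matrix.trace, Finset.sum_mul]
    refine Finset.sum_congr rfl fun i _ => ?_
    rw [Matrix.diag_apply, Matrix.mul_apply, Finset.sum_mul]
    exact Finset.sum_congr rfl fun j _ => by rw [← mul_assoc]; rfl
  rw [h, ← mul_add, ← map_add, crossTerm, Finset.sum_mul, ← Finset.sum_add_distrib]
  simp only [map_sum, wickExp_X_mul, Finset.sum_mul, ← Finset.sum_add_distrib, Finset.mul_sum]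
  refine Finset.sum_congr rfl fun i _ => Finset.sum_congr rfl fun j _ => ?_
  rw [Derivation.leibniz, smul_eq_mul, smul_eq_mul]
  congr 2
  ring

end Generic

/-! ### Semicircle moments and Wigner's theorem for products of traces. -/

/-- Moments of the standard semicircle law. -/
def wignerMoment (k : ℕ) : ℝ := if Odd k then 0 else catalan (k / 2)

theorem wignerMoment_zero : wignerMoment 0 = 1 := by simp [wignerMoment]

theorem wignerMoment_one : wignerMoment 1 = 0 := by simp [wignerMoment]

theorem wignerMoment_nonneg (k : ℕ) : 0 ≤ wignerMoment k := by
  rw [wignerMoment]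
  split_ifs <;> simp

theorem wignerMoment_two_mul (m : ℕ) : wignerMoment (2 * m) = catalan m := by
  simp [wignerMoment]

/-- This is the Catalan recursion: pairs with an odd member contribute zero, and the even pairs are
the doubles of those in `catalan_succ'`. -/
theorem wignerMoment_add_two (k : ℕ) :
    wignerMoment (k + 2) =
      ∑ p ∈ Finset.HasAntidiagonal.antidiagonal k, wignerMoment p.1 * wignerMoment p.2 := by
  rcases Nat.even_or_odd' k with ⟨m, rfl | rfl⟩
  · rw [show 2 * m + 2 = 2 * (m + 1) by ring, wignerMoment_two_mul, catalan_succ', Nat.cast_sum]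
    refine Finset.sum_of_injOn (fun p : ℕ × ℕ => (2 * p.1, 2 * p.2)) ?_ ?_ ?_ ?_
    · rintro ⟨a, b⟩ - ⟨c, d⟩ - h
      simp only [Prod.mk.injEq] at h ⊢
      omega
    · rintro ⟨a, b⟩ h
      simp only [Finset.mem_coe, Finset.HasAntidiagonal.mem_antidiagonal] at h ⊢
      omega
    · rintro ⟨a, b⟩ h h'
      simp only [Finset.HasAntidiagonal.mem_antidiagonal] at h
      rcases Nat.even_or_odd' a with ⟨c, rfl | rfl⟩
      · refine absurd ⟨(c, m - c), ?_, ?_⟩ h'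
        · simp only [Finset.mem_coe, Finset.HasAntidiagonal.mem_antidiagonal]
          omega
        · simp only [Prod.mk.injEq, true_and]
          omega
      · simp [wignerMoment]
    · rintro ⟨a, b⟩ -
      simp [wignerMoment_two_mul]
  · rw [Finset.sum_eq_zero]
    · have : Odd (2 * m + 1 + 2) := ⟨m + 1, by ring⟩
      simp [wignerMoment, this]
    · rintro ⟨a, b⟩ h
      simp only [Finset.HasAntidiagonal.mem_antidiagonal] at h
      rcases Nat.even_or_odd' a with ⟨c, rfl | rfl⟩
      · have : Odd b := ⟨m - c, by omega⟩
        simp [wignerMoment, this]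
      · simp [wignerMoment]

/-- Products of semicircle moments. -/
def wignerProd (L : List ℕ) : ℝ := (L.map wignerMoment).prod

theorem wignerProd_cons (k : ℕ) (L : List ℕ) :
    wignerProd (k :: L) = wignerMoment k * wignerProd L := by
  simp [wignerProd]

theorem wickExp_tracePow_add_two_mul_ge {N : ℕ} {s : ℝ} (hs : 0 ≤ s) (k : ℕ)
    {Q : MvPolynomial (UpperIndex N) ℝ} (hQ : Q ∈ nonnegCoeff (UpperIndex N)) :
    s * ∑ p ∈ Finset.HasAntidiagonal.antidiagonal k,
        wickExp s (tracePow N p.1 * (tracePow N p.2 * Q)) ≤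
      wickExp s (tracePow N (k + 2) * Q) := by
  rw [wickExp_tracePow_succ_mul, sum_pderiv_pow_apply]
  have h := mul_nonneg hs (wickExp_nonneg hs (crossTerm_mem (k + 1) hQ))
  refine le_trans (mul_le_mul_of_nonneg_left ?_ hs) (le_add_of_nonneg_right h)
  rw [← map_sum]
  refine wickExp_mono hs ?_
  rw [Finset.sum_mul, ← Finset.sum_sub_distrib]
  refine sum_mem fun p _ => ?_
  have : (tracePow N p.1 * tracePow N p.2 + offDiagTrace N p.1 p.2) * Q -
      tracePow N p.1 * (tracePow N p.2 * Q) = offDiagTrace N p.1 p.2 * Q := by ring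
  rw [this]
  exact mul_mem (offDiagTrace_mem _ _) hQ

/-- Each of the `k + 1` off-diagonal corrections is dominated by the single trace of the `k`-th
power. -/
theorem wickExp_tracePow_add_two_mul_le {N : ℕ} {s : ℝ} (hs : 0 ≤ s) (k : ℕ)
    {Q : MvPolynomial (UpperIndex N) ℝ} (hQ : Q ∈ nonnegCoeff (UpperIndex N)) :
    wickExp s (tracePow N (k + 2) * Q) ≤
      s * ∑ p ∈ Finset.HasAntidiagonal.antidiagonal k,
        wickExp s (tracePow N p.1 * (tracePow N p.2 * Q)) +
      s * ((k + 1) * wickExp s (tracePow N k * Q)) + s * wickExp s (crossTerm N (k + 1) Q) := by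
  rw [wickExp_tracePow_succ_mul, sum_pderiv_pow_apply, ← mul_add s (∑ _ ∈ _, _)]
  refine add_le_add_left (mul_le_mul_of_nonneg_left ?_ hs) _
  have : (k + 1) * wickExp s (tracePow N k * Q) =
      ∑ p ∈ Finset.HasAntidiagonal.antidiagonal k, wickExp s (tracePow N k * Q) := by
    simp
  rw [this, ← Finset.sum_add_distrib, Finset.sum_mul, map_sum]
  refine Finset.sum_le_sum fun p hp => ?_
  rw [← map_add]
  refine wickExp_mono hs ?_
  have h₁ : tracePow N p.1 * (tracePow N p.2 * Q) + tracePow N k * Q -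
      (tracePow N p.1 * tracePow N p.2 + offDiagTrace N p.1 p.2) * Q =
      (tracePow N k - offDiagTrace N p.1 p.2) * Q := by ring
  rw [h₁, ← Finset.HasAntidiagonal.mem_antidiagonal.1 hp]
  exact mul_mem (tracePow_sub_offDiagTrace_mem _ _) hQ

theorem wickExp_tracePow_one_mul {N : ℕ} (s : ℝ) (Q : MvPolynomial (UpperIndex N) ℝ) :
    wickExp s (tracePow N 1 * Q) = s * wickExp s (crossTerm N 0 Q) := by
  rw [wickExp_tracePow_succ_mul]
  have : ∑ i : Fin N, ∑ j : Fin N,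
      MvPolynomial.pderiv (upperIndex i j) ((genericSymm N ^ 0) j i) = 0 := by
    refine Finset.sum_eq_zero fun i _ => Finset.sum_eq_zero fun j _ => ?_
    rw [pow_zero, Matrix.one_apply]
    split_ifs <;> simp
  rw [this, zero_mul, map_zero, mul_zero, zero_add]

theorem wickExp_tracePow_zero_mul {N : ℕ} (s : ℝ) (Q : MvPolynomial (UpperIndex N) ℝ) :
    wickExp s (tracePow N 0 * Q) = N * wickExp s Q := by
  rw [tracePow_zero, ← nsmul_eq_mul, map_nsmul, nsmul_eq_mul]

/-- Splitting `k + 2` into two indices of sum `k` lowers the sum of the list, while the extra trace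
contributes a factor `N` cancelled by the variance `1/N`. A leading `0` leaves the sum unchanged,
hence the inner induction on the list. -/
theorem le_wickExp_traceProd {N : ℕ} (hN : 1 ≤ N) (L : List ℕ) :
    (N : ℝ) ^ L.length * wignerProd L ≤ wickExp (N : ℝ)⁻¹ (traceProd N L) := by
  have hN' : (0 : ℝ) < N := by exact_mod_cast hN
  have hs : (0 : ℝ) ≤ (N : ℝ)⁻¹ := by positivity
  induction hn : L.sum using Nat.strong_induction_on generalizing L with
  | _ n ih =>
  subst hn
  induction L with
  | nil => simp [wignerProd, traceProd, wickExp_one]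
  | cons k L ihL =>
    rw [traceProd_cons, wignerProd_cons, List.length_cons]
    match k, ih, ihL with
    | 0, ih, ihL =>
      rw [wickExp_tracePow_zero_mul, wignerMoment_zero, one_mul, pow_succ', mul_assoc]
      refine mul_le_mul_of_nonneg_left (ihL fun m hm L' hL' => ih m (by simpa using hm) L' hL') ?_
      exact hN'.le
    | 1, ih, ihL =>
      rw [wickExp_tracePow_one_mul, wignerMoment_one, zero_mul, mul_zero]
      exact mul_nonneg hs (wickExp_nonneg hs (crossTerm_mem _ (traceProd_mem _)))
    | k + 2, ih, ihL =>
      refine le_trans ?_ (wickExp_tracePow_add_two_mul_ge hs k (traceProd_mem L))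
      rw [wignerMoment_add_two, Finset.sum_mul, Finset.mul_sum, Finset.mul_sum]
      refine Finset.sum_le_sum fun p hp => ?_
      have hp' := Finset.HasAntidiagonal.mem_antidiagonal.1 hp
      have := ih (p.1 :: p.2 :: L).sum (by simp only [List.sum_cons]; omega) (p.1 :: p.2 :: L) rfl
      rw [traceProd_cons, traceProd_cons, wignerProd_cons, wignerProd_cons, List.length_cons,
        List.length_cons] at this
      refine le_trans (le_of_eq ?_) (mul_le_mul_of_nonneg_left this hs)
      field_simp
      ring

/-- The derivative terms falling on other traces are of lower order. -/
theorem wickExp_crossTerm_traceProd_le (n : ℕ)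
    (ih : ∀ L : List ℕ, L.sum < n → ∃ C : ℝ, 0 ≤ C ∧ ∀ N : ℕ, 1 ≤ N →
      wickExp (N : ℝ)⁻¹ (traceProd N L) ≤ (N : ℝ) ^ L.length * C)
    (k : ℕ) (L Q : List ℕ) (h : k + L.sum + Q.sum ≤ n) :
    ∃ C : ℝ, 0 ≤ C ∧ ∀ N : ℕ, 1 ≤ N →
      wickExp (N : ℝ)⁻¹ (crossTerm N k (traceProd N L) * traceProd N Q) ≤
        (N : ℝ) ^ (L.length + Q.length) * C := by
  induction L generalizing Q with
  | nil => exact ⟨0, le_rfl, fun N _ => by simp [traceProd, crossTerm]⟩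
  | cons t L ihL =>
    rw [List.sum_cons] at h
    -- In the product rule either `t` is differentiated, or it becomes a passive factor and joins
    -- `Q`.
    obtain ⟨C₁, hC₁, h₁⟩ := ihL (t :: Q) (by rw [List.sum_cons]; omega)
    have h₂ : ∃ C : ℝ, 0 ≤ C ∧ ∀ N : ℕ, 1 ≤ N →
        wickExp (N : ℝ)⁻¹ (crossTerm N k (tracePow N t) * traceProd N L * traceProd N Q) ≤
          (N : ℝ) ^ (L.length + Q.length + 1) * C := by
      cases t with
      | zero => exact ⟨0, le_rfl, fun N _ => by simp [crossTerm_tracePow_zero]⟩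
      | succ t =>
        obtain ⟨C, hC, hb⟩ := ih ((k + t) :: (L ++ Q)) (by simp; omega)
        -- The derivative merges the two traces into one of index `k + t`, so the total sum falls
        -- below `n`; the `2` counts the trace and the off-diagonal term it dominates.
        refine ⟨2 * (t + 1) * C, by positivity, fun N hN => ?_⟩
        have hs : (0 : ℝ) ≤ (N : ℝ)⁻¹ := by positivity
        have hb' := hb N hN
        rw [traceProd_cons, traceProd_append, List.length_cons, List.length_append] at hb'
        have : wickExp (N : ℝ)⁻¹ (crossTerm N k (tracePow N (t + 1)) * traceProd N L *
            traceProd N Q) ≤ (2 * (t + 1)) * wickExp (N : ℝ)⁻¹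
              (tracePow N (k + t) * (traceProd N L * traceProd N Q)) := by
          have e : (2 * (t + 1) : ℝ) * wickExp (N : ℝ)⁻¹
              (tracePow N (k + t) * (traceProd N L * traceProd N Q)) =
              wickExp (N : ℝ)⁻¹ (((2 * (t + 1) : ℕ) : MvPolynomial (UpperIndex N) ℝ) *
                (tracePow N (k + t) * (traceProd N L * traceProd N Q))) := by
            rw [← nsmul_eq_mul, map_nsmul, nsmul_eq_mul]
            push_cast
            rfl
          rw [e]
          refine wickExp_mono hs ?_
          rw [crossTerm_tracePow_succ]
          have e₂ : ((2 * (t + 1) : ℕ) : MvPolynomial (UpperIndex N) ℝ) *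
                (tracePow N (k + t) * (traceProd N L * traceProd N Q)) -
              (t + 1) * (tracePow N (k + t) + offDiagTrace N k t) * traceProd N L *
                traceProd N Q = ((t + 1 : ℕ) : MvPolynomial (UpperIndex N) ℝ) *
              ((tracePow N (k + t) - offDiagTrace N k t) * (traceProd N L * traceProd N Q)) := by
            push_cast
            ring
          rw [e₂]
          exact mul_mem (natCast_mem _ _) (mul_mem (tracePow_sub_offDiagTrace_mem _ _)
            (mul_mem (traceProd_mem _) (traceProd_mem _)))
        refine this.trans ((mul_le_mul_of_nonneg_left hb' (by positivity)).trans (le_of_eq ?_))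
        ring
    obtain ⟨C₂, hC₂, h₂⟩ := h₂
    refine ⟨C₂ + C₁, add_nonneg hC₂ hC₁, fun N hN => ?_⟩
    have e : crossTerm N k (traceProd N (t :: L)) * traceProd N Q =
        crossTerm N k (tracePow N t) * traceProd N L * traceProd N Q +
          crossTerm N k (traceProd N L) * traceProd N (t :: Q) := by
      rw [traceProd_cons, traceProd_cons, crossTerm_mul]
      ring
    rw [e, map_add]
    refine (add_le_add (h₂ N hN) (h₁ N hN)).trans (le_of_eq ?_)
    simp only [List.length_cons]
    ring

/-- The same double induction as for the lower bound. Relative to the leading order, the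
off-diagonal corrections are `O(1/N)` and the cross terms `O(1/N²)`. -/
theorem wickExp_traceProd_le (L : List ℕ) :
    ∃ C : ℝ, 0 ≤ C ∧ ∀ N : ℕ, 1 ≤ N →
      wickExp (N : ℝ)⁻¹ (traceProd N L) ≤ (N : ℝ) ^ L.length * (wignerProd L + C / N) := by
  induction hn : L.sum using Nat.strong_induction_on generalizing L with
  | _ n ih =>
  have ihb : ∀ L : List ℕ, L.sum < n → ∃ C : ℝ, 0 ≤ C ∧ ∀ N : ℕ, 1 ≤ N →
      wickExp (N : ℝ)⁻¹ (traceProd N L) ≤ (N : ℝ) ^ L.length * C := by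
    intro L hL
    obtain ⟨C, hC, h⟩ := ih L.sum hL L rfl
    refine ⟨wignerProd L + C, add_nonneg (List.prod_nonneg ?_) hC, fun N hN => ?_⟩
    · intro x hx
      obtain ⟨k, -, rfl⟩ := List.mem_map.1 hx
      exact wignerMoment_nonneg k
    · refine (h N hN).trans ?_
      gcongr
      exact div_le_self hC (by exact_mod_cast hN)
  subst hn
  induction L with
  | nil => exact ⟨0, le_rfl, fun N _ => by simp [wignerProd, traceProd, wickExp_one]⟩
  | cons k L ihL =>
    match k, ih, ihb, ihL with
    | 0, ih, ihb, ihL =>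
      simp only [List.sum_cons, zero_add] at ih ihb
      obtain ⟨C, hC, h⟩ := ihL ih ihb
      refine ⟨C, hC, fun N hN => ?_⟩
      rw [traceProd_cons, wignerProd_cons, List.length_cons, wickExp_tracePow_zero_mul,
        wignerMoment_zero, one_mul, pow_succ', mul_assoc]
      exact mul_le_mul_of_nonneg_left (h N hN) (Nat.cast_nonneg _)
    | 1, ih, ihb, ihL =>
      obtain ⟨C, hC, h⟩ := wickExp_crossTerm_traceProd_le _ ihb 0 L [] (by simp)
      refine ⟨C, hC, fun N hN => ?_⟩
      have hN' : (1 : ℝ) ≤ N := by exact_mod_cast hN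
      have h' := h N hN
      rw [show traceProd N [] = 1 from rfl, mul_one, List.length_nil, add_zero] at h'
      rw [traceProd_cons, wignerProd_cons, List.length_cons, wickExp_tracePow_one_mul,
        wignerMoment_one, zero_mul, zero_add]
      refine (mul_le_mul_of_nonneg_left h' (by positivity)).trans ?_
      have e : (N : ℝ) ^ (L.length + 1) * (C / N) = N ^ L.length * C := by
        field_simp
        ring
      rw [e]
      exact mul_le_of_le_one_left (by positivity) (inv_le_one_of_one_le₀ hN')
    | k + 2, ih, ihb, ihL =>
      obtain ⟨C₁, hC₁, h₁⟩ := wickExp_crossTerm_traceProd_le _ ihb (k + 1) L [] (by simp)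
      obtain ⟨C₂, hC₂, h₂⟩ := ihb (k :: L) (by simp)
      -- Membership of `p` is placed inside the existential so that the chosen constant depends on
      -- `p` alone.
      have h₃ : ∀ p : ℕ × ℕ, ∃ C : ℝ, 0 ≤ C ∧ (p ∈ Finset.HasAntidiagonal.antidiagonal k →
          ∀ N : ℕ, 1 ≤ N → wickExp (N : ℝ)⁻¹ (traceProd N (p.1 :: p.2 :: L)) ≤
            (N : ℝ) ^ (L.length + 2) *
              (wignerMoment p.1 * wignerMoment p.2 * wignerProd L + C / N)) := by
        intro p
        by_cases hp : p ∈ Finset.HasAntidiagonal.antidiagonal k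
        · have hp' := Finset.HasAntidiagonal.mem_antidiagonal.1 hp
          obtain ⟨C, hC, h⟩ := ih (p.1 :: p.2 :: L).sum
            (by simp only [List.sum_cons]; omega) (p.1 :: p.2 :: L) rfl
          refine ⟨C, hC, fun _ N hN => ?_⟩
          have := h N hN
          rwa [wignerProd_cons, wignerProd_cons, ← mul_assoc] at this
        · exact ⟨0, le_rfl, fun h => absurd h hp⟩
      choose C₃ hC₃ h₃ using h₃
      refine ⟨∑ p ∈ Finset.HasAntidiagonal.antidiagonal k, C₃ p + (k + 1) * C₂ + C₁,
        add_nonneg (add_nonneg (Finset.sum_nonneg fun p _ => hC₃ p) (by positivity)) hC₁,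
        fun N hN => ?_⟩
      have hN' : (1 : ℝ) ≤ N := by exact_mod_cast hN
      have hs : (0 : ℝ) ≤ (N : ℝ)⁻¹ := by positivity
      have h₁' := h₁ N hN
      have h₂' := h₂ N hN
      rw [show traceProd N [] = 1 from rfl, mul_one, List.length_nil, add_zero] at h₁'
      rw [traceProd_cons, List.length_cons] at h₂'
      rw [traceProd_cons, wignerProd_cons, List.length_cons]
      refine (wickExp_tracePow_add_two_mul_le hs k (traceProd_mem L)).trans ?_
      have b₁ : (N : ℝ)⁻¹ * ∑ p ∈ Finset.HasAntidiagonal.antidiagonal k,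
          wickExp (N : ℝ)⁻¹ (tracePow N p.1 * (tracePow N p.2 * traceProd N L)) ≤
          N ^ (L.length + 1) * (wignerMoment (k + 2) * wignerProd L +
            (∑ p ∈ Finset.HasAntidiagonal.antidiagonal k, C₃ p) / N) := by
        rw [wignerMoment_add_two, Finset.sum_mul, Finset.sum_div, ← Finset.sum_add_distrib,
          Finset.mul_sum, Finset.mul_sum]
        refine Finset.sum_le_sum fun p hp => ?_
        have := h₃ p hp N hN
        rw [traceProd_cons, traceProd_cons] at this
        refine (mul_le_mul_of_nonneg_left this hs).trans (le_of_eq ?_)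
        field_simp
        ring
      have b₂ : (N : ℝ)⁻¹ * ((k + 1) * wickExp (N : ℝ)⁻¹ (tracePow N k * traceProd N L)) ≤
          N ^ (L.length + 1) * ((k + 1) * C₂ / N) := by
        refine (mul_le_mul_of_nonneg_left (mul_le_mul_of_nonneg_left h₂' (by positivity))
          hs).trans (le_of_eq ?_)
        field_simp
      have b₃ : (N : ℝ)⁻¹ * wickExp (N : ℝ)⁻¹ (crossTerm N (k + 1) (traceProd N L)) ≤
          N ^ (L.length + 1) * (C₁ / N) := by
        refine (mul_le_mul_of_nonneg_left h₁' hs).trans ?_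
        have e : (N : ℝ) ^ (L.length + 1) * (C₁ / N) = N ^ L.length * C₁ := by
          field_simp
          ring
        rw [e]
        exact mul_le_of_le_one_left (by positivity) (inv_le_one_of_one_le₀ hN')
      refine (add_le_add (add_le_add b₁ b₂) b₃).trans (le_of_eq ?_)
      ring

/-- Wigner's theorem for the expected moments. -/
theorem tendsto_wickExp_tracePow (k : ℕ) :
    Tendsto (fun N : ℕ => wickExp (N : ℝ)⁻¹ (tracePow N k) / N) atTop (𝓝 (wignerMoment k)) := by
  obtain ⟨C, hC, h⟩ := wickExp_traceProd_le [k]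
  have hlim : Tendsto (fun N : ℕ => wignerMoment k + C / N) atTop (𝓝 (wignerMoment k)) := by
    simpa using tendsto_const_nhds.add (tendsto_const_div_atTop_nhds_zero_nat C)
  refine tendsto_of_tendsto_of_tendsto_of_le_of_le' tendsto_const_nhds hlim ?_ ?_
  · filter_upwards [eventually_ge_atTop 1] with N hN
    have hN' : (0 : ℝ) < N := by exact_mod_cast hN
    have := le_wickExp_traceProd hN [k]
    simp only [traceProd, wignerProd, List.map_cons, List.map_nil, List.prod_cons, List.prod_nil,
      mul_one, List.length_cons, List.length_nil, zero_add, pow_one] at this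
    rwa [le_div_iff₀' hN']
  · filter_upwards [eventually_ge_atTop 1] with N hN
    have hN' : (0 : ℝ) < N := by exact_mod_cast hN
    have := h N hN
    simp only [traceProd, wignerProd, List.map_cons, List.map_nil, List.prod_cons, List.prod_nil,
      mul_one, List.length_cons, List.length_nil, zero_add, pow_one] at this
    rwa [div_le_iff₀' hN']

/-! ### Off-diagonal cancellation and scaling. -/

theorem aeval_genericSymm {N : ℕ} {A : Type*} [CommRing A] [Algebra ℝ A] (x : UpperIndex N → A)
    (k : ℕ) (i j : Fin N) :
    MvPolynomial.aeval x ((genericSymm N ^ k) i j) =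
      ((Matrix.of fun a b => x (upperIndex a b) : Matrix (Fin N) (Fin N) A) ^ k) i j := by
  have h : (genericSymm N).map (MvPolynomial.aeval x) =
      (Matrix.of fun a b => x (upperIndex a b) : Matrix (Fin N) (Fin N) A) := by
    refine Matrix.ext fun a b => ?_
    simp [genericSymm]
  rw [← h]
  have := Matrix.map_pow (genericSymm N) (MvPolynomial.aeval (R := ℝ) x).toRingHom k
  exact congrFun (congrFun this i) j

/-- Conjugation by the diagonal sign matrix that is `-1` only at `i` leaves the expectation
invariant, odd moments being zero, but negates the `(i,j)` entry of every power. The expectation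
therefore equals its own negative. -/
theorem wickExp_genericSymm_pow_of_ne {N : ℕ} (s : ℝ) (k : ℕ) {i j : Fin N} (hij : i ≠ j) :
    wickExp s ((genericSymm N ^ k) i j) = 0 := by
  classical
  let d : Fin N → ℝ := fun a => if a = i then -1 else 1
  have hd (a : Fin N) : d a * d a = 1 := by
    simp only [d]
    split_ifs <;> norm_num
  have hsym (n : ℕ) (c : ℝ) (hc : c * c = 1) : c ^ n * gaussMoment s n = gaussMoment s n := by
    rw [pow_mul_gaussMoment, sq, hc, one_mul]
  have h := wickExp_rescale s s (fun p : UpperIndex N => d p.1.1 * d p.1.2)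
    (fun p n => hsym n _ (by rw [mul_mul_mul_comm, hd, hd, one_mul])) ((genericSymm N ^ k) i j)
  let D : Matrix (Fin N) (Fin N) (MvPolynomial (UpperIndex N) ℝ) :=
    Matrix.diagonal fun a => MvPolynomial.C (d a)
  have hD : D * D = 1 := by
    simp only [D, Matrix.diagonal_mul_diagonal, ← map_mul, hd, map_one, Matrix.diagonal_one]
  have hM : (Matrix.of fun a b => MvPolynomial.C (d (upperIndex a b).1.1 * d (upperIndex a b).1.2) *
      MvPolynomial.X (upperIndex a b)) = D * genericSymm N * D := by
    refine Matrix.ext fun a b => ?_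
    rw [Matrix.of_apply, Matrix.mul_diagonal, Matrix.diagonal_mul, genericSymm, Matrix.of_apply,
      mul_right_comm, ← map_mul]
    congr 2
    rcases le_total a b with hab | hab
    · simp [upperIndex, hab]
    · simp [upperIndex, hab, mul_comm]
  have hpow : (D * genericSymm N * D) ^ k = D * genericSymm N ^ k * D := by
    clear h
    induction k with
    | zero => simp [hD]
    | succ k ih =>
      rw [pow_succ, ih, pow_succ]
      calc _ = D * genericSymm N ^ k * (D * D) * genericSymm N * D := by simp only [mul_assoc]
        _ = _ := by rw [hD, mul_one]; simp only [mul_assoc]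
  rw [aeval_genericSymm, hM, hpow, Matrix.mul_diagonal, Matrix.diagonal_mul, mul_right_comm,
    ← map_mul, MvPolynomial.C_mul', map_smul] at h
  simp only [d, if_true, hij.symm, if_false, smul_eq_mul] at h
  linarith

theorem wickExp_sum_genericSymm_pow {N : ℕ} (s : ℝ) (k : ℕ) :
    wickExp s (∑ i, ∑ j, (genericSymm N ^ k) i j) = wickExp s (tracePow N k) := by
  simp only [tracePow, Matrix.trace, Matrix.diag_apply, map_sum]
  refine Finset.sum_congr rfl fun i _ => ?_
  rw [Finset.sum_eq_single i (fun j _ h => wickExp_genericSymm_pow_of_ne s k h.symm) (by simp)]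

theorem wickExp_tracePow_scale {N : ℕ} (c s : ℝ) (k : ℕ) :
    wickExp (c ^ 2 * s) (tracePow N k) = c ^ k * wickExp s (tracePow N k) := by
  rw [← wickExp_rescale s (c ^ 2 * s) (fun _ => c) (fun _ n => pow_mul_gaussMoment c s n)]
  have hM : (Matrix.of fun a b => MvPolynomial.C c * MvPolynomial.X (upperIndex a b)) =
      (MvPolynomial.C c : MvPolynomial (UpperIndex N) ℝ) • genericSymm N := by
    refine Matrix.ext fun a b => ?_
    simp [genericSymm]
  have : MvPolynomial.aeval (fun p => MvPolynomial.C c * MvPolynomial.X p) (tracePow N k) =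
      c ^ k • tracePow N k := by
    simp only [tracePow, Matrix.trace, map_sum, Matrix.diag_apply, Finset.smul_sum]
    refine Finset.sum_congr rfl fun i _ => ?_
    rw [aeval_genericSymm, hM, smul_pow, Matrix.smul_apply, smul_eq_mul, ← map_pow,
      MvPolynomial.C_mul']
  rw [this, map_smul, smul_eq_mul]

/-! ### From the formal functional to actual expectations. -/

theorem integrable_pow_gaussianReal (v : NNReal) (n : ℕ) :
    Integrable (fun x : ℝ => x ^ n) (gaussianReal 0 v) := by
  have h := (memLp_id_gaussianReal (μ := 0) (v := v) (n : NNReal)).integrable_norm_pow'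
  refine (integrable_norm_iff (by fun_prop)).1 ?_
  simpa using h

theorem integrable_pow_mul_gaussianPDFReal {v : NNReal} (hv : v ≠ 0) (n : ℕ) :
    Integrable (fun x : ℝ => x ^ n * gaussianPDFReal 0 v x) := by
  have h := integrable_pow_gaussianReal v n
  rw [gaussianReal_of_var_ne_zero _ hv,
    integrable_withDensity_iff_integrable_smul' (measurable_gaussianPDF _ _)
      (ae_of_all _ fun _ => gaussianPDF_lt_top)] at h
  simpa [toReal_gaussianPDF, mul_comm] using h

theorem hasDerivAt_gaussianPDFReal {v : NNReal} (hv : v ≠ 0) (x : ℝ) :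
    HasDerivAt (fun y => -(v : ℝ) * gaussianPDFReal 0 v y) (x * gaussianPDFReal 0 v x) x := by
  have hv' : (v : ℝ) ≠ 0 := by exact_mod_cast hv
  simp only [gaussianPDFReal_def, sub_zero]
  have h₁ : HasDerivAt (fun y : ℝ => -y ^ 2 / (2 * v)) (-(2 * x) / (2 * v)) x := by
    have := ((hasDerivAt_pow 2 x).neg).div_const (2 * (v : ℝ))
    simpa using this
  have := ((h₁.exp).const_mul (√(2 * Real.pi * v))⁻¹).const_mul (-(v : ℝ))
  refine this.congr_deriv ?_
  field_simp

/-- Integration by parts, with `x * gaussianPDFReal 0 v x` as the derivative of `-v *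
gaussianPDFReal 0 v x`, reproduces the recursion defining `gaussMoment`. -/
theorem integral_pow_gaussianReal {v : NNReal} (hv : v ≠ 0) :
    ∀ n : ℕ, ∫ x, x ^ n ∂(gaussianReal 0 v) = gaussMoment v n
  | 0 => by simp [gaussMoment]
  | 1 => by simp [gaussMoment, integral_id_gaussianReal]
  | n + 2 => by
    have h := integral_mul_deriv_eq_deriv_mul_of_integrable
      (u := fun x : ℝ => x ^ (n + 1)) (v := fun y => -(v : ℝ) * gaussianPDFReal 0 v y)
      (u' := fun x => (n + 1) * x ^ n) (v' := fun x => x * gaussianPDFReal 0 v x)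
      (fun x _ => by simpa using hasDerivAt_pow (n + 1) x)
      (fun x _ => hasDerivAt_gaussianPDFReal hv x)
      ((integrable_pow_mul_gaussianPDFReal hv (n + 2)).congr
        (ae_of_all _ fun x => by simp only [Pi.mul_apply]; ring))
      (((integrable_pow_mul_gaussianPDFReal hv n).const_mul (-(v : ℝ) * (n + 1))).congr
        (ae_of_all _ fun x => by simp only [Pi.mul_apply]; ring))
      (((integrable_pow_mul_gaussianPDFReal hv (n + 1)).const_mul (-(v : ℝ))).congr
        (ae_of_all _ fun x => by simp only [Pi.mul_apply]; ring))
    rw [gaussMoment, ← integral_pow_gaussianReal hv n, integral_gaussianReal_eq_integral_smul hv,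
      integral_gaussianReal_eq_integral_smul hv, ← integral_const_mul]
    rw [← integral_neg] at h
    calc _ = ∫ x : ℝ, x ^ (n + 1) * (x * gaussianPDFReal 0 v x) := by
          refine integral_congr_ae (ae_of_all _ fun x => ?_)
          simp only [smul_eq_mul]
          ring
      _ = _ := h
      _ = _ := by
          refine integral_congr_ae (ae_of_all _ fun x => ?_)
          simp only [smul_eq_mul]
          ring

section Expectation

variable {Ω : Type*} [MeasurableSpace Ω] {P : Measure Ω} {N : ℕ}
  {W : Ω → Matrix (Fin N) (Fin N) ℝ} {σ : ℝ}

/-- The entries of a matrix on and above the diagonal. -/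
def upperEntries (M : Matrix (Fin N) (Fin N) ℝ) (p : UpperIndex N) : ℝ := M p.1.1 p.1.2

theorem IsSymmetricGaussian.hasLaw_upperEntries [IsProbabilityMeasure P]
    (h : IsSymmetricGaussian P W σ) :
    HasLaw (fun ω => upperEntries (W ω))
      (Measure.pi fun _ : UpperIndex N => gaussianReal 0 (σ ^ 2).toNNReal) P :=
  h.indep.hasLaw_pi fun p => h.law _ _ p.2

theorem integral_aeval_pi_gaussian {ι : Type*} [Fintype ι] {v : NNReal} (hv : v ≠ 0)
    (F : MvPolynomial ι ℝ) :
    Integrable (fun x : ι → ℝ => MvPolynomial.aeval x F) (Measure.pi fun _ => gaussianReal 0 v) ∧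
      ∫ x, MvPolynomial.aeval x F ∂(Measure.pi fun _ : ι => gaussianReal 0 v) = wickExp v F := by
  induction F using MvPolynomial.induction_on' with
  | add F G hF hG =>
    simp only [map_add]
    exact ⟨hF.1.add hG.1, by rw [integral_add hF.1 hG.1, hF.2, hG.2]⟩
  | monomial m a =>
    have e (x : ι → ℝ) : MvPolynomial.aeval x (MvPolynomial.monomial m a) =
        a * ∏ p, x p ^ m p := by
      rw [MvPolynomial.aeval_monomial, Finsupp.prod_fintype _ _ (by simp)]
      rfl
    simp only [e]
    refine ⟨Integrable.const_mul ?_ a, ?_⟩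
    · exact Integrable.fintype_prod (f := fun p (y : ℝ) => y ^ m p)
        fun p => integrable_pow_gaussianReal v (m p)
    · rw [integral_const_mul, wickExp_monomial,
        integral_fintype_prod_eq_prod (fun p (y : ℝ) => y ^ m p)]
      simp only [integral_pow_gaussianReal hv]

theorem IsSymmetricGaussian.integral_aeval [IsProbabilityMeasure P]
    (h : IsSymmetricGaussian P W σ) (hσ : σ ≠ 0) (F : MvPolynomial (UpperIndex N) ℝ) :
    Integrable (fun ω => MvPolynomial.aeval (upperEntries (W ω)) F) P ∧
      ∫ ω, MvPolynomial.aeval (upperEntries (W ω)) F ∂P = wickExp (σ ^ 2) F := by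
  have hv : (σ ^ 2).toNNReal ≠ 0 := by
    simpa using hσ
  have hl := h.hasLaw_upperEntries
  obtain ⟨h₁, h₂⟩ := integral_aeval_pi_gaussian hv F
  constructor
  · rw [← hl.map_eq] at h₁
    exact h₁.comp_aemeasurable hl.aemeasurable
  · have := hl.integral_comp (f := fun x => MvPolynomial.aeval x F) h₁.aestronglyMeasurable
    rw [h₂, Real.coe_toNNReal _ (sq_nonneg σ)] at this
    exact this

theorem pathSum_eq_sum_pow (M : Matrix (Fin N) (Fin N) ℝ) (i : Fin N) (l : ℕ) :
    pathSum M i l = ∑ j, (M ^ l) i j := by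
  induction l generalizing i with
  | zero => simp [pathSum, Matrix.one_apply]
  | succ l ih =>
    have h : pathSum M i (l + 1) = ∑ k, M i k * pathSum M k l := by
      rw [pathSum, ← (Fin.consEquiv fun _ : Fin (l + 1) => Fin N).sum_comp, Fintype.sum_prod_type]
      refine Finset.sum_congr rfl fun k _ => ?_
      rw [pathSum, Finset.mul_sum]
      refine Finset.sum_congr rfl fun j _ => ?_
      rw [Fin.prod_univ_succ]
      rfl
    rw [h, pow_succ']
    simp only [ih, Matrix.mul_apply, Finset.mul_sum]
    exact Finset.sum_comm

/-- Path sums are row sums of powers; symmetry of `M ^ l₁` lets the sum over `i` become a matrix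
product. -/
theorem sum_pathSum_mul_pathSum {M : Matrix (Fin N) (Fin N) ℝ} (hM : M.IsSymm) (l₁ l₂ : ℕ) :
    ∑ i, pathSum M i l₁ * pathSum M i l₂ =
      MvPolynomial.aeval (upperEntries M) (∑ i, ∑ j, (genericSymm N ^ (l₁ + l₂)) i j) := by
  have e : (Matrix.of fun a b => upperEntries M (upperIndex a b)) = M := by
    refine Matrix.ext fun a b => ?_
    rcases le_total a b with hab | hab
    · simp [upperEntries, upperIndex, hab]
    · simp [upperEntries, upperIndex, hab, hM.apply]
  simp only [map_sum, aeval_genericSymm]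
  simp only [e, pathSum_eq_sum_pow, pow_add, Matrix.mul_apply, Finset.sum_mul_sum]
  rw [Finset.sum_comm]
  refine Finset.sum_congr rfl fun j _ => ?_
  rw [Finset.sum_comm]
  refine Finset.sum_congr rfl fun k _ => Finset.sum_congr rfl fun i _ => ?_
  rw [(hM.pow l₁).apply]

theorem IsSymmetricGaussian.integrable_sum_pathSum [IsProbabilityMeasure P]
    (h : IsSymmetricGaussian P W σ) (hσ : σ ≠ 0) (l₁ l₂ : ℕ) :
    Integrable (fun ω => ∑ i, pathSum (W ω) i l₁ * pathSum (W ω) i l₂) P :=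
  (h.integral_aeval hσ _).1.congr
    (h.symm.mono fun _ hω => (sum_pathSum_mul_pathSum hω l₁ l₂).symm)

theorem IsSymmetricGaussian.genMomentMatrix_apply [IsProbabilityMeasure P]
    (h : IsSymmetricGaussian P W σ) (hσ : σ ≠ 0) (T : ℕ) (l₁ l₂ : Fin (T + 1)) :
    genMomentMatrix P W T l₁ l₂ = wickExp (σ ^ 2) (tracePow N (l₁ + l₂)) := by
  rw [genMomentMatrix, Matrix.of_apply, ← wickExp_sum_genericSymm_pow,
    ← (h.integral_aeval hσ _).2]
  exact integral_congr_ae (h.symm.mono fun _ hω => sum_pathSum_mul_pathSum hω l₁ l₂)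

end Expectation

/-! ### Moments of the semicircle law. -/

section Semicircle

theorem integral_cos_pow_zero_pi_add_two (n : ℕ) :
    ∫ θ in (0 : ℝ)..Real.pi, Real.cos θ ^ (n + 2) =
      (n + 1) / (n + 2) * ∫ θ in (0 : ℝ)..Real.pi, Real.cos θ ^ n := by
  rw [integral_cos_pow]
  simp

theorem integral_cos_pow_odd (m : ℕ) :
    ∫ θ in (0 : ℝ)..Real.pi, Real.cos θ ^ (2 * m + 1) = 0 := by
  induction m with
  | zero => simp
  | succ m ih =>
    rw [show 2 * (m + 1) + 1 = 2 * m + 1 + 2 by ring, integral_cos_pow_zero_pi_add_two, ih,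
      mul_zero]

theorem integral_cos_pow_even (m : ℕ) :
    ∫ θ in (0 : ℝ)..Real.pi, Real.cos θ ^ (2 * m) = Real.pi * m.centralBinom / 4 ^ m := by
  induction m with
  | zero => simp
  | succ m ih =>
    have h : ((m : ℝ) + 1) * (m + 1).centralBinom = 2 * (2 * m + 1) * m.centralBinom := by
      exact_mod_cast Nat.succ_mul_centralBinom_succ m
    rw [show 2 * (m + 1) = 2 * m + 2 by ring, integral_cos_pow_zero_pi_add_two, ih]
    have h' : ((m + 1).centralBinom : ℝ) = 2 * (2 * m + 1) * m.centralBinom / (m + 1) := by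
      field_simp
      linarith
    rw [h']
    push_cast
    field_simp
    ring

theorem integral_cos_pow_mul_sin_sq (n : ℕ) :
    ∫ θ in (0 : ℝ)..Real.pi, Real.cos θ ^ n * Real.sin θ ^ 2 =
      (∫ θ in (0 : ℝ)..Real.pi, Real.cos θ ^ n) / (n + 2) := by
  have h : ∀ θ : ℝ, Real.cos θ ^ n * Real.sin θ ^ 2 = Real.cos θ ^ n - Real.cos θ ^ (n + 2) := by
    intro θ
    rw [Real.sin_sq]
    ring
  simp only [h]
  rw [intervalIntegral.integral_sub (Continuous.intervalIntegrable (by fun_prop) _ _)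
    (Continuous.intervalIntegrable (by fun_prop) _ _), integral_cos_pow_zero_pi_add_two]
  field_simp
  ring

/-- Substitute `x = -2ρ cos θ`, which increases from `-2ρ` to `2ρ` on `[0, π]`, where `sin θ ≥ 0`
removes the square root. -/
theorem integral_pow_mul_sqrt {ρ : ℝ} (hρ : 0 < ρ) (n : ℕ) :
    ∫ x in (-(2 * ρ))..(2 * ρ), x ^ n * √(4 * ρ ^ 2 - x ^ 2) =
      (2 * ρ) ^ (n + 2) * (-1) ^ n *
        ∫ θ in (0 : ℝ)..Real.pi, Real.cos θ ^ n * Real.sin θ ^ 2 := by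
  have h := intervalIntegral.integral_comp_mul_deriv (a := 0) (b := Real.pi)
    (f := fun θ => -(2 * ρ) * Real.cos θ) (f' := fun θ => 2 * ρ * Real.sin θ)
    (g := fun x => x ^ n * √(4 * ρ ^ 2 - x ^ 2))
    (fun θ _ => by simpa using (Real.hasDerivAt_cos θ).const_mul (-(2 * ρ)))
    (by fun_prop) (by fun_prop)
  simp only [Real.cos_zero, Real.cos_pi, mul_one, mul_neg, neg_neg] at h
  rw [← h, ← intervalIntegral.integral_const_mul]
  refine intervalIntegral.integral_congr fun θ hθ => ?_
  rw [Set.uIcc_of_le Real.pi_pos.le] at hθ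
  have hs : √(4 * ρ ^ 2 - (-(2 * ρ) * Real.cos θ) ^ 2) = 2 * ρ * Real.sin θ := by
    rw [show 4 * ρ ^ 2 - (-(2 * ρ) * Real.cos θ) ^ 2 = (2 * ρ * Real.sin θ) ^ 2 by
      rw [mul_pow (2 * ρ), Real.sin_sq]; ring]
    exact Real.sqrt_sq (mul_nonneg (by positivity) (Real.sin_nonneg_of_mem_Icc hθ))
  simp only [Function.comp]
  rw [hs, neg_mul, neg_pow, mul_pow]
  ring

/-- The density of the semicircle law. -/
def semicircleDensity (ρ x : ℝ) : ℝ :=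
  1 / (2 * Real.pi * ρ ^ 2) * √(max (4 * ρ ^ 2 - x ^ 2) 0)

theorem semicircleDensity_nonneg (ρ x : ℝ) : 0 ≤ semicircleDensity ρ x := by
  have := Real.pi_pos
  rw [semicircleDensity]
  positivity

theorem continuous_semicircleDensity (ρ : ℝ) : Continuous (semicircleDensity ρ) := by
  unfold semicircleDensity
  fun_prop

theorem semicircleDensity_eq_zero {ρ x : ℝ} (hρ : 0 < ρ) (hx : x ∉ Set.Ioc (-(2 * ρ)) (2 * ρ)) :
    semicircleDensity ρ x = 0 := by
  have : 4 * ρ ^ 2 - x ^ 2 ≤ 0 := by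
    rw [Set.mem_Ioc, not_and_or, not_lt, not_le] at hx
    rcases hx with hx | hx <;> nlinarith
  rw [semicircleDensity, max_eq_right this, Real.sqrt_zero, mul_zero]

theorem integrable_pow_mul_semicircleDensity {ρ : ℝ} (hρ : 0 < ρ) (n : ℕ) :
    Integrable fun x : ℝ => semicircleDensity ρ x * x ^ n := by
  refine Continuous.integrable_of_hasCompactSupport
    ((continuous_semicircleDensity ρ).mul (by fun_prop)) ?_
  refine HasCompactSupport.intro (isCompact_Icc (a := -(2 * ρ)) (b := 2 * ρ)) fun x hx => ?_
  rw [semicircleDensity_eq_zero hρ fun h => hx (Set.Ioc_subset_Icc_self h), zero_mul]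

theorem integral_pow_mul_semicircleDensity {ρ : ℝ} (hρ : 0 < ρ) (n : ℕ) :
    ∫ x : ℝ, semicircleDensity ρ x * x ^ n = ρ ^ n * wignerMoment n := by
  have hpi := Real.pi_pos
  have h₀ : ∫ x : ℝ, semicircleDensity ρ x * x ^ n =
      1 / (2 * Real.pi * ρ ^ 2) *
        ∫ x in (-(2 * ρ))..(2 * ρ), x ^ n * √(4 * ρ ^ 2 - x ^ 2) := by
    rw [← setIntegral_eq_integral_of_forall_compl_eq_zero (s := Set.Ioc (-(2 * ρ)) (2 * ρ))
      fun x hx => by rw [semicircleDensity_eq_zero hρ hx, zero_mul],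
      ← intervalIntegral.integral_of_le (by linarith), ← intervalIntegral.integral_const_mul]
    refine intervalIntegral.integral_congr fun x hx => ?_
    rw [Set.uIcc_of_le (by linarith)] at hx
    have : 0 ≤ 4 * ρ ^ 2 - x ^ 2 := by nlinarith [hx.1, hx.2]
    simp only [semicircleDensity, max_eq_left this]
    ring
  rw [h₀, integral_pow_mul_sqrt hρ, integral_cos_pow_mul_sin_sq]
  rcases Nat.even_or_odd' n with ⟨m, rfl | rfl⟩
  · have hc : (m.centralBinom : ℝ) = (m + 1) * catalan m := by
      exact_mod_cast (succ_mul_catalan_eq_centralBinom m).symm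
    rw [wignerMoment_two_mul, integral_cos_pow_even, hc, pow_mul (-1 : ℝ)]
    have h4 : (4 : ℝ) ^ m = 2 ^ (2 * m) := by rw [pow_mul]; norm_num
    rw [h4, pow_add, mul_pow]
    push_cast
    field_simp
    norm_num
  · rw [integral_cos_pow_odd]
    simp [wignerMoment]

theorem isProbabilityMeasure_semicircleLaw {ρ : ℝ} (hρ : 0 < ρ) :
    IsProbabilityMeasure (semicircleLaw ρ) := by
  refine ⟨?_⟩
  rw [semicircleLaw, withDensity_apply _ MeasurableSet.univ, Measure.restrict_univ]
  change ∫⁻ x, ENNReal.ofReal (semicircleDensity ρ x) = 1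
  have h₁ := integrable_pow_mul_semicircleDensity hρ 0
  have h₂ := integral_pow_mul_semicircleDensity hρ 0
  simp only [pow_zero, mul_one, wignerMoment_zero] at h₁ h₂
  rw [← ofReal_integral_eq_lintegral_ofReal h₁ (ae_of_all _ (semicircleDensity_nonneg ρ)), h₂,
    ENNReal.ofReal_one]

theorem integrable_pow_semicircleLaw {ρ : ℝ} (hρ : 0 < ρ) (n : ℕ) :
    Integrable (fun x : ℝ => x ^ n) (semicircleLaw ρ) := by
  rw [show semicircleLaw ρ = volume.withDensity fun x => ENNReal.ofReal (semicircleDensity ρ x)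
    from rfl, integrable_withDensity_iff_integrable_smul'
      (continuous_semicircleDensity ρ).measurable.ennreal_ofReal (ae_of_all _ fun _ => by simp)]
  simp only [ENNReal.toReal_ofReal (semicircleDensity_nonneg ρ _), smul_eq_mul]
  exact integrable_pow_mul_semicircleDensity hρ n

theorem integral_pow_semicircleLaw {ρ : ℝ} (hρ : 0 < ρ) (n : ℕ) :
    ∫ x, x ^ n ∂(semicircleLaw ρ) = ρ ^ n * wignerMoment n := by
  rw [show semicircleLaw ρ = volume.withDensity fun x => ENNReal.ofReal (semicircleDensity ρ x)
    from rfl, integral_withDensity_eq_integral_toReal_smul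
      (continuous_semicircleDensity ρ).measurable.ennreal_ofReal (ae_of_all _ fun _ => by simp)]
  simp only [ENNReal.toReal_ofReal (semicircleDensity_nonneg ρ _), smul_eq_mul]
  exact integral_pow_mul_semicircleDensity hρ n

theorem wignerMoment_two_mul_eq (m : ℕ) :
    wignerMoment (2 * m) = ((2 * m).choose m : ℝ) / (m + 1) := by
  have hc : (((2 * m).choose m : ℕ) : ℝ) = (m + 1) * catalan m := by
    exact_mod_cast (succ_mul_catalan_eq_centralBinom m).symm
  rw [wignerMoment_two_mul, hc]
  field_simp

theorem semicircleMatrix_apply (ρ : ℝ) (T : ℕ) (l₁ l₂ : Fin (T + 1)) :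
    semicircleMatrix ρ T l₁ l₂ = ρ ^ ((l₁ : ℕ) + l₂) * wignerMoment (l₁ + l₂) := by
  rw [semicircleMatrix, Matrix.of_apply]
  generalize (l₁ : ℕ) + l₂ = n
  rcases Nat.even_or_odd' n with ⟨m, rfl | rfl⟩
  · rw [wignerMoment_two_mul_eq, if_neg (by simp), Nat.mul_div_cancel_left m two_pos]
    ring
  · simp [wignerMoment]

end Semicircle

/-! ### Variational description and continuity of extreme eigenvalues. -/

section Eigenvalues

open Matrix

variable {T : ℕ} {A B : Matrix (Fin (T + 1)) (Fin (T + 1)) ℝ}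

/-- Spectral decomposition of the quadratic form of a symmetric matrix. -/
theorem exists_spectral_quadForm (hA : A.IsHermitian) :
    ∃ c : (Fin (T + 1) → ℝ) → Fin (T + 1) → ℝ,
      (∀ x, x ⬝ᵥ A *ᵥ x = ∑ k, sortedEigenvalue hA k * c x k ^ 2) ∧
      (∀ x, x ⬝ᵥ x = ∑ k, c x k ^ 2) ∧
      ∀ k, ∃ x, c x = Pi.single k 1 := by
  have hT := isSymmetric_toEuclideanLin_iff.mpr hA
  let b := hT.eigenvectorBasis finrank_euclideanSpace
  let e : Fin (T + 1) ≃ Fin (Fintype.card (Fin (T + 1))) :=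
    finCongr (Fintype.card_fin (T + 1)).symm
  have hinner (x y : EuclideanSpace ℝ (Fin (T + 1))) :
      WithLp.ofLp x ⬝ᵥ WithLp.ofLp y = ∑ k, b.repr x (e k) * b.repr y (e k) := by
    rw [e.sum_comp fun k => b.repr x k * b.repr y k]
    have := b.repr.inner_map_map x y
    rw [EuclideanSpace.inner_eq_star_dotProduct, EuclideanSpace.inner_eq_star_dotProduct] at this
    simp only [star_trivial] at this
    rw [dotProduct_comm, ← this, dotProduct_comm]
    rfl
  refine ⟨fun x k => b.repr (WithLp.toLp 2 x) (e k), fun x => ?_, fun x => ?_, fun k => ?_⟩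
  · have := hinner (WithLp.toLp 2 x) (toEuclideanLin A (WithLp.toLp 2 x))
    rw [toLpLin_apply] at this
    refine this.trans (Finset.sum_congr rfl fun k _ => ?_)
    have h := hT.eigenvectorBasis_apply_self_apply finrank_euclideanSpace (WithLp.toLp 2 x) (e k)
    rw [toLpLin_apply] at h
    change _ * b.repr _ (e k) = _
    rw [h]
    change _ * (sortedEigenvalue hA k * b.repr _ (e k)) = _
    ring
  · refine (hinner (WithLp.toLp 2 x) (WithLp.toLp 2 x)).trans (Finset.sum_congr rfl fun k _ => ?_)
    ring
  · refine ⟨WithLp.ofLp (b (e k)), ?_⟩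
    funext j
    simp [Pi.single_apply]

theorem sortedEigenvalue_le_lambdaMax (hA : A.IsHermitian) (k : Fin (T + 1)) :
    sortedEigenvalue hA k ≤ lambdaMax hA :=
  hA.eigenvalues₀_antitone (Fin.zero_le k)

theorem lambdaMin_le_sortedEigenvalue (hA : A.IsHermitian) (k : Fin (T + 1)) :
    lambdaMin hA ≤ sortedEigenvalue hA k :=
  hA.eigenvalues₀_antitone (Fin.le_last k)

theorem quadForm_le_lambdaMax (hA : A.IsHermitian) (x : Fin (T + 1) → ℝ) :
    x ⬝ᵥ A *ᵥ x ≤ lambdaMax hA * (x ⬝ᵥ x) := by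
  obtain ⟨c, h₁, h₂, -⟩ := exists_spectral_quadForm hA
  rw [h₁, h₂, Finset.mul_sum]
  exact Finset.sum_le_sum fun k _ =>
    mul_le_mul_of_nonneg_right (sortedEigenvalue_le_lambdaMax hA k) (sq_nonneg _)

theorem lambdaMin_le_quadForm (hA : A.IsHermitian) (x : Fin (T + 1) → ℝ) :
    lambdaMin hA * (x ⬝ᵥ x) ≤ x ⬝ᵥ A *ᵥ x := by
  obtain ⟨c, h₁, h₂, -⟩ := exists_spectral_quadForm hA
  rw [h₁, h₂, Finset.mul_sum]
  exact Finset.sum_le_sum fun k _ =>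
    mul_le_mul_of_nonneg_right (lambdaMin_le_sortedEigenvalue hA k) (sq_nonneg _)

theorem exists_quadForm_eq_sortedEigenvalue (hA : A.IsHermitian) (k : Fin (T + 1)) :
    ∃ x : Fin (T + 1) → ℝ, x ⬝ᵥ x = 1 ∧ x ⬝ᵥ A *ᵥ x = sortedEigenvalue hA k := by
  obtain ⟨c, h₁, h₂, h₃⟩ := exists_spectral_quadForm hA
  obtain ⟨x, hx⟩ := h₃ k
  refine ⟨x, ?_, ?_⟩
  · simp [h₂, hx, Pi.single_apply]
  · simp [h₁, hx, Pi.single_apply]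

/-- An upper bound for the quadratic form attained at a unit vector determines the top eigenvalue,
so scaled and one-entry matrices need no diagonalisation. -/
theorem lambdaMax_eq_of_quadForm (hA : A.IsHermitian) {c : ℝ}
    (h : ∀ x : Fin (T + 1) → ℝ, x ⬝ᵥ A *ᵥ x ≤ c * (x ⬝ᵥ x))
    (h' : ∃ x : Fin (T + 1) → ℝ, x ⬝ᵥ x = 1 ∧ x ⬝ᵥ A *ᵥ x = c) : lambdaMax hA = c := by
  obtain ⟨x, hx, hxc⟩ := h'
  obtain ⟨y, hy, hyc⟩ := exists_quadForm_eq_sortedEigenvalue hA 0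
  refine le_antisymm ?_ ?_
  · have := h y
    rw [hy, hyc, mul_one] at this
    exact this
  · have := quadForm_le_lambdaMax hA x
    rwa [hx, hxc, mul_one] at this

theorem lambdaMin_eq_of_quadForm (hA : A.IsHermitian) {c : ℝ}
    (h : ∀ x : Fin (T + 1) → ℝ, c * (x ⬝ᵥ x) ≤ x ⬝ᵥ A *ᵥ x)
    (h' : ∃ x : Fin (T + 1) → ℝ, x ⬝ᵥ x = 1 ∧ x ⬝ᵥ A *ᵥ x = c) : lambdaMin hA = c := by
  obtain ⟨x, hx, hxc⟩ := h'
  obtain ⟨y, hy, hyc⟩ := exists_quadForm_eq_sortedEigenvalue hA (Fin.last T)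
  refine le_antisymm ?_ ?_
  · have := lambdaMin_le_quadForm hA x
    rwa [hx, hxc, mul_one] at this
  · have := h y
    rw [hy, hyc, mul_one] at this
    exact this

theorem lambdaMax_smul (hA : A.IsHermitian) {c : ℝ} (hc : 0 ≤ c) (hcA : (c • A).IsHermitian) :
    lambdaMax hcA = c * lambdaMax hA := by
  refine lambdaMax_eq_of_quadForm hcA (fun x => ?_) ?_
  · rw [smul_mulVec, dotProduct_smul, smul_eq_mul, mul_assoc]
    exact mul_le_mul_of_nonneg_left (quadForm_le_lambdaMax hA x) hc
  · obtain ⟨x, hx, hxA⟩ := exists_quadForm_eq_sortedEigenvalue hA 0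
    exact ⟨x, hx, by rw [smul_mulVec, dotProduct_smul, smul_eq_mul, hxA]; rfl⟩

theorem lambdaMin_smul (hA : A.IsHermitian) {c : ℝ} (hc : 0 ≤ c) (hcA : (c • A).IsHermitian) :
    lambdaMin hcA = c * lambdaMin hA := by
  refine lambdaMin_eq_of_quadForm hcA (fun x => ?_) ?_
  · rw [smul_mulVec, dotProduct_smul, smul_eq_mul, mul_assoc]
    exact mul_le_mul_of_nonneg_left (lambdaMin_le_quadForm hA x) hc
  · obtain ⟨x, hx, hxA⟩ := exists_quadForm_eq_sortedEigenvalue hA (Fin.last T)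
    exact ⟨x, hx, by rw [smul_mulVec, dotProduct_smul, smul_eq_mul, hxA]; rfl⟩

theorem lambdaMax_single {k : Fin (T + 1)} {c : ℝ} (hc : 0 ≤ c)
    (hA : (Matrix.single k k c).IsHermitian) : lambdaMax hA = c := by
  have h (x : Fin (T + 1) → ℝ) : x ⬝ᵥ Matrix.single k k c *ᵥ x = c * x k ^ 2 := by
    simp only [dotProduct, mulVec, Matrix.single_apply, ite_and]
    simp
    ring
  refine lambdaMax_eq_of_quadForm hA (fun x => ?_) ⟨Pi.single k 1, by simp, by simp⟩
  rw [h]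
  refine mul_le_mul_of_nonneg_left ?_ hc
  rw [sq]
  exact Finset.single_le_sum (f := fun i => x i * x i) (fun i _ => mul_self_nonneg _)
    (Finset.mem_univ k)

theorem sum_sortedEigenvalue (hA : A.IsHermitian) : ∑ k, sortedEigenvalue hA k = A.trace := by
  rw [hA.trace_eq_sum_eigenvalues]
  simp only [RCLike.ofReal_real_eq_id, id, IsHermitian.eigenvalues, sortedEigenvalue]
  rw [(Fintype.equivOfCardEq (Fintype.card_fin _)).symm.sum_comp hA.eigenvalues₀]
  exact (finCongr (Fintype.card_fin (T + 1)).symm).sum_comp hA.eigenvalues₀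

/-- The coordinates of a unit vector are at most `1` in absolute value. -/
theorem abs_quadForm_sub_le {x : Fin (T + 1) → ℝ} (hx : x ⬝ᵥ x = 1) :
    |x ⬝ᵥ A *ᵥ x - x ⬝ᵥ B *ᵥ x| ≤ ∑ i, ∑ j, |A i j - B i j| := by
  have hx' (i : Fin (T + 1)) : |x i| ≤ 1 := by
    rw [← sq_le_one_iff_abs_le_one, ← hx, sq]
    exact Finset.single_le_sum (f := fun i => x i * x i) (fun i _ => mul_self_nonneg _)
      (Finset.mem_univ i)
  have e : x ⬝ᵥ A *ᵥ x - x ⬝ᵥ B *ᵥ x = ∑ i, ∑ j, x i * ((A i j - B i j) * x j) := by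
    simp only [dotProduct, mulVec, Finset.mul_sum, ← Finset.sum_sub_distrib]
    exact Finset.sum_congr rfl fun i _ => Finset.sum_congr rfl fun j _ => by ring
  rw [e]
  refine (Finset.abs_sum_le_sum_abs _ _).trans (Finset.sum_le_sum fun i _ => ?_)
  refine (Finset.abs_sum_le_sum_abs _ _).trans (Finset.sum_le_sum fun j _ => ?_)
  rw [abs_mul, abs_mul]
  calc |x i| * (|A i j - B i j| * |x j|) ≤ 1 * (|A i j - B i j| * 1) := by
        gcongr
        · exact hx' i
        · exact hx' j
    _ = _ := by ring

/-- The form of `B` is tested on a top eigenvector of `A`. -/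
theorem lambdaMax_le_add (hA : A.IsHermitian) (hB : B.IsHermitian) :
    lambdaMax hA ≤ lambdaMax hB + ∑ i, ∑ j, |A i j - B i j| := by
  obtain ⟨x, hx, hxA⟩ := exists_quadForm_eq_sortedEigenvalue hA 0
  have h₁ := quadForm_le_lambdaMax hB x
  have h₂ := (abs_le.1 (abs_quadForm_sub_le (A := A) (B := B) hx)).2
  rw [hx, mul_one] at h₁
  rw [hxA] at h₂
  change sortedEigenvalue hA 0 ≤ _
  linarith

theorem lambdaMin_le_add (hA : A.IsHermitian) (hB : B.IsHermitian) :
    lambdaMin hA ≤ lambdaMin hB + ∑ i, ∑ j, |A i j - B i j| := by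
  obtain ⟨x, hx, hxB⟩ := exists_quadForm_eq_sortedEigenvalue hB (Fin.last T)
  have h₁ := lambdaMin_le_quadForm hA x
  have h₂ := (abs_le.1 (abs_quadForm_sub_le (A := A) (B := B) hx)).2
  rw [hx, mul_one] at h₁
  rw [hxB] at h₂
  change _ ≤ sortedEigenvalue hB (Fin.last T) + _
  linarith

/-- The one-sided bound, used in both directions, makes `f` Lipschitz for the entrywise `ℓ¹`
distance. -/
theorem tendsto_of_le_add_dist {f : ∀ A : Matrix (Fin (T + 1)) (Fin (T + 1)) ℝ, A.IsHermitian → ℝ}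
    (hf : ∀ A B (hA : A.IsHermitian) (hB : B.IsHermitian),
      f A hA ≤ f B hB + ∑ i, ∑ j, |A i j - B i j|)
    {ι : Type*} {l : Filter ι} {M : ι → Matrix (Fin (T + 1)) (Fin (T + 1)) ℝ}
    (hM : ∀ n, (M n).IsHermitian) (hA : A.IsHermitian)
    (h : ∀ i j, Tendsto (fun n => M n i j) l (𝓝 (A i j))) :
    Tendsto (fun n => f (M n) (hM n)) l (𝓝 (f A hA)) := by
  rw [tendsto_iff_dist_tendsto_zero]
  have hd : Tendsto (fun n => ∑ i, ∑ j, |M n i j - A i j|) l (𝓝 0) := by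
    have : Tendsto (fun n => ∑ i, ∑ j, |M n i j - A i j|) l
        (𝓝 (∑ i, ∑ j, |A i j - A i j|)) :=
      tendsto_finsetSum _ fun i _ => tendsto_finsetSum _ fun j _ => ((h i j).sub_const _).abs
    simpa using this
  refine squeeze_zero (fun _ => dist_nonneg) (fun n => ?_) hd
  rw [Real.dist_eq, abs_le]
  have h₁ := hf (M n) A (hM n) hA
  have h₂ := hf A (M n) hA (hM n)
  simp only [abs_sub_comm (A _ _)] at h₂
  constructor <;> linarith

/-- Convergence of the extreme eigenvalues and of the dominance ratio of a sequence of symmetric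
matrices that converges after normalisation. -/
theorem tendsto_eigenvalues_of_tendsto_div
    {M : ℕ → Matrix (Fin (T + 1)) (Fin (T + 1)) ℝ} (hM : ∀ n, (M n).IsHermitian)
    (hA : A.IsHermitian) (htr : A.trace ≠ 0) {a : ℕ → ℝ} (ha : ∀ᶠ n in atTop, 0 < a n)
    (h : ∀ i j, Tendsto (fun n => M n i j / a n) atTop (𝓝 (A i j))) :
    Tendsto (fun n => lambdaMax (hM n) / a n) atTop (𝓝 (lambdaMax hA)) ∧
    Tendsto (fun n => lambdaMin (hM n) / a n) atTop (𝓝 (lambdaMin hA)) ∧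
    Tendsto (fun n => dominanceRatio (hM n)) atTop (𝓝 (lambdaMax hA / A.trace)) := by
  have hM' (n : ℕ) : ((a n)⁻¹ • M n).IsHermitian := by
    have := hM n
    rw [IsHermitian, conjTranspose_smul, this, star_trivial]
  have h' (i j : Fin (T + 1)) :
      Tendsto (fun n => ((a n)⁻¹ • M n) i j) atTop (𝓝 (A i j)) := by
    simpa [div_eq_inv_mul] using h i j
  have hmax : Tendsto (fun n => lambdaMax (hM n) / a n) atTop (𝓝 (lambdaMax hA)) := by
    refine (tendsto_of_le_add_dist (f := fun _ hA => lambdaMax hA)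
      (fun _ _ hA hB => lambdaMax_le_add hA hB) hM' hA h').congr' ?_
    filter_upwards [ha] with n hn
    rw [lambdaMax_smul (hM n) (inv_nonneg.2 hn.le), div_eq_inv_mul]
  refine ⟨hmax, ?_, ?_⟩
  · refine (tendsto_of_le_add_dist (f := fun _ hA => lambdaMin hA)
      (fun _ _ hA hB => lambdaMin_le_add hA hB) hM' hA h').congr' ?_
    filter_upwards [ha] with n hn
    rw [lambdaMin_smul (hM n) (inv_nonneg.2 hn.le), div_eq_inv_mul]
  · have ht : Tendsto (fun n => (M n).trace / a n) atTop (𝓝 A.trace) := by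
      simp only [Matrix.trace, Matrix.diag_apply, Finset.sum_div]
      exact tendsto_finsetSum _ fun i _ => h i i
    refine (hmax.div ht htr).congr' ?_
    filter_upwards [ha] with n hn
    rw [Pi.div_apply, dominanceRatio, sum_sortedEigenvalue, div_div_div_cancel_right₀ hn.ne']

end Eigenvalues

/-! ### Normalisation and the three regimes. -/

/-- The standard deviation `ρ / N^α` is `ρ N^(1/2-α)` times the Wigner normalisation `N^(-1/2)`, and
the trace is homogeneous in the entries. -/
theorem genMomentMatrix_div_eq {Ω : Type*} [MeasurableSpace Ω] {P : Measure Ω}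
    [IsProbabilityMeasure P] {N : ℕ} (hN : 1 ≤ N) {W : Ω → Matrix (Fin N) (Fin N) ℝ} {ρ α : ℝ}
    (hρ : 0 < ρ) (h : IsSymmetricGaussian P W (ρ / (N : ℝ) ^ α)) (T : ℕ) (l₁ l₂ : Fin (T + 1)) :
    genMomentMatrix P W T l₁ l₂ / N =
      (ρ * (N : ℝ) ^ (1 / 2 - α)) ^ ((l₁ : ℕ) + l₂) *
        (wickExp (N : ℝ)⁻¹ (tracePow N (l₁ + l₂)) / N) := by
  have hN' : (0 : ℝ) < N := by exact_mod_cast hN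
  have hσ : ρ / (N : ℝ) ^ α ≠ 0 := (div_pos hρ (Real.rpow_pos_of_pos hN' α)).ne'
  have e : (ρ / (N : ℝ) ^ α) ^ 2 = (ρ * (N : ℝ) ^ (1 / 2 - α)) ^ 2 * (N : ℝ)⁻¹ := by
    have h₁ : ((N : ℝ) ^ (1 / 2 : ℝ)) ^ 2 = N := by
      rw [← Real.sqrt_eq_rpow, Real.sq_sqrt hN'.le]
    rw [Real.rpow_sub hN', div_pow, mul_pow, div_pow, h₁]
    field_simp
  rw [h.genMomentMatrix_apply hσ, e, wickExp_tracePow_scale, mul_div_assoc]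

theorem semicircleMatrix_trace_pos {ρ : ℝ} (hρ : 0 < ρ) (T : ℕ) :
    0 < (semicircleMatrix ρ T).trace := by
  simp only [Matrix.trace, Matrix.diag_apply, semicircleMatrix_apply]
  refine Finset.sum_pos' (fun i _ => mul_nonneg (by positivity) (wignerMoment_nonneg _))
    ⟨0, Finset.mem_univ _, by simp [wignerMoment_zero]⟩

theorem isEquivalent_of_tendsto_div {f a : ℕ → ℝ} {c : ℝ} (hc : c ≠ 0)
    (ha : ∀ᶠ n in atTop, 0 < a n) (h : Tendsto (fun n => f n / a n) atTop (𝓝 c)) :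
    f ~[atTop] fun n => c * a n := by
  rw [isEquivalent_iff_tendsto_one (ha.mono fun n hn => mul_ne_zero hc hn.ne')]
  have := h.div_const c
  rw [div_self hc] at this
  refine this.congr fun n => ?_
  rw [Pi.div_apply, div_div, mul_comm]

theorem single_diag_isHermitian {T : ℕ} (k : Fin (T + 1)) (c : ℝ) :
    (Matrix.single k k c).IsHermitian := by
  rw [Matrix.IsHermitian, Matrix.conjTranspose_single, star_trivial]

end

theorem mainTheorem3 (T : ℕ) (hT : 1 ≤ T) (ρ : ℝ) (hρ : 0 < ρ) (α : ℝ)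
    (Ω : ℕ → Type*) [∀ N, MeasurableSpace (Ω N)]
    (P : ∀ N, Measure (Ω N)) [∀ N, IsProbabilityMeasure (P N)]
    (W : ∀ N, Ω N → Matrix (Fin N) (Fin N) ℝ)
    (hW : ∀ N, 1 ≤ N → IsSymmetricGaussian (P N) (W N) (ρ / (N : ℝ) ^ α)) :
    -- the expectations defining `B_{T,N}` exist
    (∀ N, 1 ≤ N → ∀ l₁ l₂ : Fin (T + 1),
      Integrable (fun ω => ∑ i, pathSum (W N ω) i l₁ * pathSum (W N ω) i l₂) (P N)) ∧
    -- `A_sc(ρ,T)` is the Hankel matrix of moments of the rescaled semicircle law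
    (IsProbabilityMeasure (semicircleLaw ρ) ∧
      ∀ l₁ l₂ : Fin (T + 1),
        Integrable (fun x : ℝ => x ^ ((l₁ : ℕ) + (l₂ : ℕ))) (semicircleLaw ρ) ∧
        semicircleMatrix ρ T l₁ l₂ = ∫ x, x ^ ((l₁ : ℕ) + (l₂ : ℕ)) ∂(semicircleLaw ρ)) ∧
    (α = 1 / 2 →
      (∀ l₁ l₂ : Fin (T + 1),
        Tendsto (fun N : ℕ => genMomentMatrix (P N) (W N) T l₁ l₂ / (N : ℝ)) atTop
          (𝓝 (semicircleMatrix ρ T l₁ l₂))) ∧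
      Tendsto (fun N : ℕ => lambdaMax (genMomentMatrix_isHermitian (P N) (W N) T) / (N : ℝ)) atTop
        (𝓝 (lambdaMax (semicircleMatrix_isHermitian ρ T))) ∧
      Tendsto (fun N : ℕ => lambdaMin (genMomentMatrix_isHermitian (P N) (W N) T) / (N : ℝ)) atTop
        (𝓝 (lambdaMin (semicircleMatrix_isHermitian ρ T))) ∧
      Tendsto (fun N : ℕ => dominanceRatio (genMomentMatrix_isHermitian (P N) (W N) T)) atTop
        (𝓝 (lambdaMax (semicircleMatrix_isHermitian ρ T) / (semicircleMatrix ρ T).trace))) ∧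
    (α < 1 / 2 →
      (fun N : ℕ => lambdaMax (genMomentMatrix_isHermitian (P N) (W N) T)) ~[atTop]
        (fun N : ℕ => ρ ^ (2 * T) / ((T : ℝ) + 1) * (Nat.choose (2 * T) T : ℝ) *
          (N : ℝ) ^ (1 + 2 * (T : ℝ) * (1 / 2 - α))) ∧
      Tendsto (fun N : ℕ => dominanceRatio (genMomentMatrix_isHermitian (P N) (W N) T)) atTop
        (𝓝 1)) ∧
    (1 / 2 < α →
      (fun N : ℕ => lambdaMax (genMomentMatrix_isHermitian (P N) (W N) T)) ~[atTop]
        (fun N : ℕ => (N : ℝ)) ∧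
      Tendsto (fun N : ℕ => dominanceRatio (genMomentMatrix_isHermitian (P N) (W N) T)) atTop
        (𝓝 1)) := by
  have hcast : ∀ᶠ N : ℕ in atTop, (0 : ℝ) < N :=
    (eventually_ge_atTop 1).mono fun N hN => by exact_mod_cast hN
  have hentry (l₁ l₂ : Fin (T + 1)) : ∀ᶠ N : ℕ in atTop,
      (ρ * (N : ℝ) ^ (1 / 2 - α)) ^ ((l₁ : ℕ) + l₂) *
        (wickExp (N : ℝ)⁻¹ (tracePow N (l₁ + l₂)) / N) =
      genMomentMatrix (P N) (W N) T l₁ l₂ / N :=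
    (eventually_ge_atTop 1).mono fun N hN => (genMomentMatrix_div_eq hN hρ (hW N hN) T l₁ l₂).symm
  refine ⟨fun N hN l₁ l₂ => ?_, ⟨isProbabilityMeasure_semicircleLaw hρ, fun l₁ l₂ =>
    ⟨integrable_pow_semicircleLaw hρ _, ?_⟩⟩, fun hα => ?_, fun hα => ?_, fun hα => ?_⟩
  · have hN' : (0 : ℝ) < N := by exact_mod_cast hN
    exact (hW N hN).integrable_sum_pathSum (div_pos hρ (Real.rpow_pos_of_pos hN' α)).ne' _ _
  · rw [semicircleMatrix_apply, integral_pow_semicircleLaw hρ]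
  · have hlim (l₁ l₂ : Fin (T + 1)) :
        Tendsto (fun N : ℕ => genMomentMatrix (P N) (W N) T l₁ l₂ / (N : ℝ)) atTop
          (𝓝 (semicircleMatrix ρ T l₁ l₂)) := by
      refine Tendsto.congr' (hentry l₁ l₂) ?_
      simp only [hα, sub_self, Real.rpow_zero, mul_one]
      rw [semicircleMatrix_apply]
      exact (tendsto_wickExp_tracePow _).const_mul _
    exact ⟨hlim, tendsto_eigenvalues_of_tendsto_div _ (semicircleMatrix_isHermitian ρ T)
      (semicircleMatrix_trace_pos hρ T).ne' hcast hlim⟩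
  -- The scale diverges. After division by `N` times its `2T`-th power, every entry of degree `l₁ +
  -- l₂ < 2T` vanishes and only the corner `(T,T)` remains.
  · have ht : Tendsto (fun N : ℕ => ρ * (N : ℝ) ^ (1 / 2 - α)) atTop atTop :=
      ((tendsto_rpow_atTop (by linarith)).comp tendsto_natCast_atTop_atTop).const_mul_atTop hρ
    have hc : 0 < wignerMoment (2 * T) := by
      rw [wignerMoment_two_mul_eq]
      have : 0 < (2 * T).choose T := Nat.choose_pos (by omega)
      positivity
    have ha : ∀ᶠ N : ℕ in atTop, 0 < (N : ℝ) * (ρ * (N : ℝ) ^ (1 / 2 - α)) ^ (2 * T) := by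
      filter_upwards [hcast] with N hN
      positivity
    have hlim (l₁ l₂ : Fin (T + 1)) :
        Tendsto (fun N : ℕ => genMomentMatrix (P N) (W N) T l₁ l₂ /
          ((N : ℝ) * (ρ * (N : ℝ) ^ (1 / 2 - α)) ^ (2 * T))) atTop
          (𝓝 (Matrix.single (Fin.last T) (Fin.last T) (wignerMoment (2 * T)) l₁ l₂)) := by
      have h₁ : Tendsto (fun N : ℕ => ((ρ * (N : ℝ) ^ (1 / 2 - α)) ^ (2 * T - (l₁ + l₂)))⁻¹ *
          (wickExp (N : ℝ)⁻¹ (tracePow N (l₁ + l₂)) / N)) atTop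
          (𝓝 (Matrix.single (Fin.last T) (Fin.last T) (wignerMoment (2 * T)) l₁ l₂)) := by
        by_cases hl : l₁ = Fin.last T ∧ l₂ = Fin.last T
        · obtain ⟨rfl, rfl⟩ := hl
          simpa [two_mul] using tendsto_wickExp_tracePow (T + T)
        · have hl' : 2 * T - ((l₁ : ℕ) + l₂) ≠ 0 := by
            rw [Fin.ext_iff, Fin.ext_iff, Fin.val_last] at hl
            omega
          rw [Matrix.single_apply, if_neg (by simpa [eq_comm] using hl)]
          have := (((tendsto_pow_atTop hl').comp ht).inv_tendsto_atTop).mul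
            (tendsto_wickExp_tracePow (l₁ + l₂))
          rwa [zero_mul] at this
      refine h₁.congr' ?_
      filter_upwards [hentry l₁ l₂, hcast] with N hN hN'
      rw [← div_div, ← hN]
      have hp : ρ * (N : ℝ) ^ (1 / 2 - α) ≠ 0 := by positivity
      have hl' : (l₁ : ℕ) + l₂ ≤ 2 * T := by omega
      rw [mul_div_right_comm, ← pow_sub_mul_pow _ hl']
      field_simp
    obtain ⟨h₁, -, h₂⟩ := tendsto_eigenvalues_of_tendsto_div
      (fun N => genMomentMatrix_isHermitian (P N) (W N) T)
      (single_diag_isHermitian (Fin.last T) (wignerMoment (2 * T)))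
      (by rw [Matrix.trace_single_eq_same]; exact hc.ne') ha hlim
    rw [lambdaMax_single hc.le] at h₁ h₂
    rw [Matrix.trace_single_eq_same, div_self hc.ne'] at h₂
    refine ⟨(isEquivalent_of_tendsto_div hc.ne' ha h₁).congr_right ?_, h₂⟩
    filter_upwards [hcast] with N hN
    rw [wignerMoment_two_mul_eq, Real.rpow_add hN, Real.rpow_one, mul_pow,
      ← Real.rpow_mul_natCast hN.le]
    push_cast
    rw [mul_comm (2 * (T : ℝ))]
    ring
  -- The scale tends to zero, so every entry of positive degree vanishes and only the corner
  -- `(0,0)`, with zeroth moment `1`, remains.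
  · have ht : Tendsto (fun N : ℕ => ρ * (N : ℝ) ^ (1 / 2 - α)) atTop (𝓝 0) := by
      have := ((tendsto_rpow_neg_atTop (y := α - 1 / 2) (by linarith)).comp
        tendsto_natCast_atTop_atTop).const_mul ρ
      simpa [Function.comp_def] using this
    have hlim (l₁ l₂ : Fin (T + 1)) :
        Tendsto (fun N : ℕ => genMomentMatrix (P N) (W N) T l₁ l₂ / (N : ℝ)) atTop
          (𝓝 (Matrix.single (0 : Fin (T + 1)) 0 (1 : ℝ) l₁ l₂)) := by
      refine Tendsto.congr' (hentry l₁ l₂) ?_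
      have := (ht.pow ((l₁ : ℕ) + l₂)).mul (tendsto_wickExp_tracePow (l₁ + l₂))
      convert this using 2
      by_cases hl : l₁ = 0 ∧ l₂ = 0
      · obtain ⟨rfl, rfl⟩ := hl
        simp [wignerMoment_zero]
      · have hl' : (l₁ : ℕ) + l₂ ≠ 0 := by
          rw [Fin.ext_iff, Fin.ext_iff, Fin.val_zero] at hl
          omega
        rw [Matrix.single_apply, if_neg (by simpa [eq_comm] using hl), zero_pow hl', zero_mul]
    obtain ⟨h₁, -, h₂⟩ := tendsto_eigenvalues_of_tendsto_div
      (fun N => genMomentMatrix_isHermitian (P N) (W N) T)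
      (single_diag_isHermitian (0 : Fin (T + 1)) 1) (by simp) hcast hlim
    rw [lambdaMax_single zero_le_one] at h₁ h₂
    rw [Matrix.trace_single_eq_same, div_self one_ne_zero] at h₂
    exact ⟨by simpa using isEquivalent_of_tendsto_div one_ne_zero hcast h₁, h₂⟩
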